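/- Let $g\ge 0$ be an integer and let $P^{g+1}_{\mathbb R}$ be the real vector space of polynomials $b(\lambda)=\sum_{i=0}^{g+1}b_i\lambda^i$ with complex coefficients satisfying $b_{g+1-i}=\overline{b_i}$ for all $i$. Let $\mathrm{Gr}(2,P^{g+1}_{\mathbb R})^\circ$ be the open subset of the Grassmannian of real $2$-planes $B\subset P^{g+1}_{\mathbb R}$ such that the only $b\in B$ with $b(0)=0$ is $b=0$; it is a real analytic manifold of dimension $2g$, parametrized by the real linear maps from the space $\simeq\mathbb R^2$ of lowest and highest coefficients to the space $\simeq\mathbb R^g$ of the remaining coefficients, whose graphs are the planes $B$. Let $R^g$ be the set of those $B\in\mathrm{Gr}(2,P^{g+1}_{\mathbb R})^\circ$ for which all $b\in B$ have a common root in $\mathbb C$, and let $S^g$ be the set of those $B$ for which all $b\in B$ have a common root on the unit circle. Write $\gcd(B)$ for the greatest common divisor in $\mathbb C[\lambda]$ of all $b\in B$. A point $B\in R^g$ is called a smooth point of $R^g$ of dimension $k$ if some neighbourhood of $B$ in $R^g$ is a $k$-dimensional embedded submanifold of $\mathrm{Gr}(2,P^{g+1}_{\mathbb R})^\circ$ (the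 statement holds both for $C^\infty$ and for real analytic submanifolds), and $\dim_B R^g$ is the largest $k$ such that every neighbourhood of $B$ contains smooth points of $R^g$ of dimension $k$. Then: (i) If $B\in S^g$, then $\dim_B R^g=2g-1$, and $B$ is a smooth point of $R^g$ if and only if $\deg\gcd(B)=1$. (ii) If $B\in R^g\setminus S^g$, then $\dim_B R^g=2g-2$, and $B$ is a smooth point of $R^g$ if and only if $\deg\gcd(B)=2$; moreover, if $R^g\setminus S^g\neq\emptyset$, then $2$ is the minimum of $\deg\gcd$ on $R^g\setminus S^g$. -/

import Mathlib

open scoped Polynomial ContDiff Manifold Topology ComplexConjugate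
open Filter

/-- The real vector space of complex polynomials `p` of degree at most `d` which are real with
respect to the involution `λ ↦ 1 / conj λ`, that is `p_{d-i} = conj p_i` for the coefficients. -/
def realPolys (d : ℕ) : Submodule ℝ ℂ[X] where
  carrier := {p | p.natDegree ≤ d ∧ ∀ i ≤ d, p.coeff (d - i) = conj (p.coeff i)}
  add_mem' := by
    rintro p q ⟨hp, hp'⟩ ⟨hq, hq'⟩
    refine ⟨Polynomial.natDegree_add_le_of_degree_le hp hq, fun i hi => ?_⟩
    simp [hp' i hi, hq' i hi]
  zero_mem' := by simp
  smul_mem' := by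
    rintro r p ⟨hp, hp'⟩
    refine ⟨(Polynomial.natDegree_smul_le r p).trans hp, fun i hi => ?_⟩
    simp [hp' i hi]

/-- The possible vectors of middle coefficients `(b_1, …, b_g)` of an element `b` of
`realPolys (g + 1)`; a real vector space of dimension `g`. -/
def midCoeffs (g : ℕ) : Submodule ℝ (Fin g → ℂ) where
  carrier := {c | ∀ k, c k.rev = conj (c k)}
  add_mem' := by
    intro c d hc hd k
    simp [hc k, hd k]
  zero_mem' := by simp
  smul_mem' := by
    intro r c hc k
    simp [hc k]

/-- The polynomial `z + c_0 λ + ⋯ + c_{g-1} λ^g + conj z λ^{g+1}` with lowest and highest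
coefficients `z`, `conj z` and middle coefficients `c`. -/
noncomputable def assemble (g : ℕ) : ℂ × midCoeffs g →ₗ[ℝ] ℂ[X] where
  toFun v := Polynomial.C v.1 + ∑ k : Fin g, Polynomial.monomial (k + 1) (v.2.1 k)
    + Polynomial.monomial (g + 1) (conj v.1)
  map_add' v w := by
    simp only [Prod.fst_add, Prod.snd_add, Submodule.coe_add, Pi.add_apply, map_add,
      Finset.sum_add_distrib]
    ring
  map_smul' r v := by
    simp only [Prod.smul_fst, Prod.smul_snd, Submodule.coe_smul, Pi.smul_apply, RingHom.id_apply,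
      smul_add, Finset.smul_sum, Polynomial.smul_monomial, Polynomial.smul_C]
    simp

/-- The open subset of the Grassmannian of real 2-planes in `realPolys (g + 1)` consisting of the
2-planes `B` such that the only `b ∈ B` with `b(0) = 0` is the zero polynomial. -/
def OpenGrassmannian (g : ℕ) : Type :=
  {B : Submodule ℝ ℂ[X] // B ≤ realPolys (g + 1) ∧ Module.finrank ℝ B = 2 ∧
    ∀ b ∈ B, b.eval 0 = 0 → b = 0}

theorem assemble_coeff_zero (g : ℕ) (v : ℂ × midCoeffs g) : (assemble g v).coeff 0 = v.1 := by
  simp [assemble, Polynomial.coeff_monomial]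

theorem assemble_coeff_last (g : ℕ) (v : ℂ × midCoeffs g) :
    (assemble g v).coeff (g + 1) = conj v.1 := by
  simp only [assemble, LinearMap.coe_mk, AddHom.coe_mk, Polynomial.coeff_add,
    Polynomial.finsetSum_coeff, Polynomial.coeff_monomial, Polynomial.coeff_C]
  rw [Finset.sum_eq_zero]
  · simp
  · intro k _
    rw [if_neg]
    have := k.2
    omega

theorem assemble_coeff_mid (g : ℕ) (v : ℂ × midCoeffs g) (k : Fin g) :
    (assemble g v).coeff (k + 1) = v.2.1 k := by
  have hk := k.2
  simp only [assemble, LinearMap.coe_mk, AddHom.coe_mk, Polynomial.coeff_add,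
    Polynomial.finsetSum_coeff, Polynomial.coeff_monomial, Polynomial.coeff_C]
  rw [Finset.sum_eq_single k]
  · simp
    intro h
    omega
  · intro j _ hj
    rw [if_neg]
    intro h
    exact hj (Fin.ext (by omega))
  · simp

theorem assemble_injective (g : ℕ) : Function.Injective (assemble g) := by
  intro v w h
  refine Prod.ext ?_ (Subtype.ext (funext fun k => ?_))
  · rw [← assemble_coeff_zero, h, assemble_coeff_zero]
  · rw [← assemble_coeff_mid, h, assemble_coeff_mid]

theorem assemble_natDegree (g : ℕ) (v : ℂ × midCoeffs g) :
    (assemble g v).natDegree ≤ g + 1 := by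
  refine Polynomial.natDegree_add_le_of_degree_le (Polynomial.natDegree_add_le_of_degree_le
    (by simp) (Polynomial.natDegree_sum_le_of_forall_le _ _ fun k _ => ?_))
    (Polynomial.natDegree_monomial_le _)
  exact (Polynomial.natDegree_monomial_le _).trans (by have := k.2; omega)

theorem assemble_mem (g : ℕ) (v : ℂ × midCoeffs g) : assemble g v ∈ realPolys (g + 1) := by
  refine ⟨assemble_natDegree g v, fun i hi => ?_⟩
  rcases Nat.eq_zero_or_pos i with rfl | h0
  · rw [Nat.sub_zero, assemble_coeff_last, assemble_coeff_zero]
  rcases Nat.eq_or_lt_of_le hi with rfl | h1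
  · rw [Nat.sub_self, assemble_coeff_last, assemble_coeff_zero, Complex.conj_conj]
  · obtain ⟨k, rfl⟩ : ∃ k : Fin g, i = k + 1 := ⟨⟨i - 1, by omega⟩, by simp; omega⟩
    have hk := k.2
    have : g + 1 - (k + 1 : ℕ) = (k.rev : ℕ) + 1 := by rw [Fin.val_rev]; omega
    rw [this, assemble_coeff_mid, assemble_coeff_mid, v.2.2 k]

theorem exists_assemble (g : ℕ) (b : ℂ[X]) (hb : b ∈ realPolys (g + 1)) :
    ∃ v, assemble g v = b := by
  refine ⟨(b.coeff 0, ⟨fun k => b.coeff (k + 1), fun k => ?_⟩), ?_⟩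
  · have hk := k.2
    have h := hb.2 (k + 1) (by omega)
    rwa [show g + 1 - (k + 1 : ℕ) = (k.rev : ℕ) + 1 by rw [Fin.val_rev]; omega] at h
  · ext i
    rcases Nat.eq_zero_or_pos i with rfl | h0
    · rw [assemble_coeff_zero]
    rcases lt_trichotomy i (g + 1) with h1 | rfl | h1
    · obtain ⟨k, rfl⟩ : ∃ k : Fin g, i = k + 1 := ⟨⟨i - 1, by omega⟩, by simp; omega⟩
      rw [assemble_coeff_mid]
    · rw [assemble_coeff_last]
      simpa using (hb.2 0 (by omega)).symm
    · rw [Polynomial.coeff_eq_zero_of_natDegree_lt ((assemble_natDegree g _).trans_lt h1),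
        Polynomial.coeff_eq_zero_of_natDegree_lt (hb.1.trans_lt h1)]

/-- The 2-plane which is the graph of a real linear map from the space `≃ ℂ` of lowest and highest
coefficients to the space of middle coefficients. -/
noncomputable def graphPlane (g : ℕ) (L : ℂ →L[ℝ] midCoeffs g) : OpenGrassmannian g :=
  ⟨(L : ℂ →ₗ[ℝ] midCoeffs g).graph.map (assemble g), by
    refine ⟨?_, ?_, ?_⟩
    · rintro _ ⟨v, -, rfl⟩
      exact assemble_mem g v
    · rw [← (Submodule.equivMapOfInjective _ (assemble_injective g) _).finrank_eq,
        LinearMap.graph_eq_range_prod, LinearMap.finrank_range_of_inj]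
      · exact Complex.finrank_real_complex
      · intro z w h
        exact congrArg Prod.fst h
    · rintro _ ⟨v, hv, rfl⟩ h
      rw [← Polynomial.coeff_zero_eq_eval_zero, assemble_coeff_zero] at h
      have hv' : v.2 = L v.1 := hv
      rw [h, map_zero] at hv'
      rw [show v = 0 from Prod.ext h hv', map_zero]⟩

theorem graphPlane_bijective (g : ℕ) : Function.Bijective (graphPlane g) := by
  constructor
  · intro L M h
    have h1 := Submodule.map_injective_of_injective (assemble_injective g)
      (congrArg Subtype.val h)
    ext1 z
    have h2 : (z, L z) ∈ (L : ℂ →ₗ[ℝ] midCoeffs g).graph := rfl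
    rw [h1] at h2
    exact h2
  · rintro ⟨B, hB, hdim, h0⟩
    have : Module.Finite ℝ B := Module.finite_of_finrank_pos (by omega)
    let p : B →ₗ[ℝ] ℂ := ((Polynomial.lcoeff ℂ 0).restrictScalars ℝ).comp B.subtype
    have hp : Function.Injective p := by
      refine (injective_iff_map_eq_zero p).2 ?_
      rintro ⟨b, hb⟩ h
      exact Subtype.ext (h0 b hb (by rw [← Polynomial.coeff_zero_eq_eval_zero]; exact h))
    let e : B ≃ₗ[ℝ] ℂ := LinearEquiv.ofBijective p ⟨hp,
      (LinearMap.injective_iff_surjective_of_finrank_eq_finrank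
        (hdim.trans Complex.finrank_real_complex.symm)).1 hp⟩
    have he : ∀ x : B, e x = x.1.coeff 0 := fun x => rfl
    let L : ℂ →ₗ[ℝ] midCoeffs g :=
      { toFun := fun z => ⟨fun k => (e.symm z).1.coeff (k + 1), fun k => by
          have hk := k.2
          have h := (hB (e.symm z).2).2 (k + 1) (by omega)
          rwa [show g + 1 - (k + 1 : ℕ) = (k.rev : ℕ) + 1 by rw [Fin.val_rev]; omega] at h⟩
        map_add' := fun z w => by ext k; simp
        map_smul' := fun r z => by ext k; simp [-Complex.real_smul, map_smul] }
    have hL : ∀ z, assemble g (z, L z) = (e.symm z).1 := by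
      intro z
      obtain ⟨v, hv⟩ := exists_assemble g _ (hB (e.symm z).2)
      rw [← hv]
      congr 1
      refine Prod.ext ?_ (Subtype.ext (funext fun k => ?_))
      · rw [← assemble_coeff_zero g v, hv, ← he, LinearEquiv.apply_symm_apply]
      · rw [← assemble_coeff_mid g v, hv]
        rfl
    refine ⟨L.toContinuousLinearMap, Subtype.ext ?_⟩
    change L.graph.map (assemble g) = B
    ext b
    constructor
    · rintro ⟨⟨z, c⟩, hv, rfl⟩
      have hc : c = L z := hv
      rw [hc, hL]
      exact (e.symm z).2
    · intro hb
      refine ⟨(e ⟨b, hb⟩, L (e ⟨b, hb⟩)), rfl, ?_⟩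
      rw [hL, LinearEquiv.symm_apply_apply]

/-- The parametrization of the open Grassmannian by linear maps: the standard Grassmannian chart
whose domain is exactly this open set. -/
noncomputable def graphEquiv (g : ℕ) : (ℂ →L[ℝ] midCoeffs g) ≃ OpenGrassmannian g :=
  Equiv.ofBijective (graphPlane g) (graphPlane_bijective g)

noncomputable instance (g : ℕ) : TopologicalSpace (OpenGrassmannian g) :=
  TopologicalSpace.induced (graphEquiv g).symm inferInstance

/-- The global chart of the open Grassmannian. -/
noncomputable def graphChart (g : ℕ) : OpenGrassmannian g ≃ₜ (ℂ →L[ℝ] midCoeffs g) :=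
  (graphEquiv g).symm.toHomeomorphOfIsInducing ⟨rfl⟩

noncomputable instance (g : ℕ) : ChartedSpace (ℂ →L[ℝ] midCoeffs g) (OpenGrassmannian g) :=
  (graphChart g).toOpenPartialHomeomorph.singletonChartedSpace rfl

instance (g : ℕ) (n : WithTop ℕ∞) :
    IsManifold 𝓘(ℝ, ℂ →L[ℝ] midCoeffs g) n (OpenGrassmannian g) :=
  (graphChart g).toOpenPartialHomeomorph.isManifold_singleton rfl

section Subvariety

variable (E : Type*) [NormedAddCommGroup E] [NormedSpace ℝ E]
  {M : Type*} [TopologicalSpace M] [ChartedSpace E M]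

/-- `x ∈ A` and, near `x`, the subset `A` of the manifold `M` is an embedded `C^n` submanifold of
dimension `k`: some `C^n` chart of `M` around `x` straightens `A` to a `k`-dimensional linear
subspace. -/
def IsSmoothPointOfDim (n : WithTop ℕ∞) (A : Set M) (k : ℕ) (x : M) : Prop :=
  x ∈ A ∧ ∃ e ∈ IsManifold.maximalAtlas 𝓘(ℝ, E) n M, x ∈ e.source ∧
    ∃ F : Submodule ℝ E, Module.finrank ℝ F = k ∧ ∀ y ∈ e.source, y ∈ A ↔ e y ∈ F

/-- `x` is a smooth point of `A`. -/
def IsSmoothPoint (n : WithTop ℕ∞) (A : Set M) (x : M) : Prop :=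
  ∃ k, IsSmoothPointOfDim E n A k x

/-- `dim_x A = k`: the number `k` is the largest dimension that smooth points of `A` have in
arbitrarily small neighbourhoods of `x`. -/
def HasLocalDim (n : WithTop ℕ∞) (A : Set M) (x : M) (k : ℕ) : Prop :=
  (∃ᶠ y in 𝓝 x, IsSmoothPointOfDim E n A k y) ∧
    ∀ᶠ y in 𝓝 x, ∀ j, IsSmoothPointOfDim E n A j y → j ≤ k

end Subvariety

/-- The planes `B` all of whose elements have a common (complex) root. -/
def commonRootLocus (g : ℕ) : Set (OpenGrassmannian g) :=
  {B | ∃ z : ℂ, ∀ b ∈ B.1, b.IsRoot z}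

/-- The planes `B` all of whose elements vanish at `z`. -/
def rootLocusAt (g : ℕ) (z : ℂ) : Set (OpenGrassmannian g) :=
  {B | ∀ b ∈ B.1, b.eval z = 0}

/-- The planes `B` all of whose elements have a common root on the unit circle. -/
def circleRootLocus (g : ℕ) : Set (OpenGrassmannian g) :=
  ⋃ z ∈ Metric.sphere (0 : ℂ) 1, rootLocusAt g z

/-- The greatest common divisor in `ℂ[X]` of the elements of `B`, determined up to a nonzero
constant: a generator of the ideal which they span. -/
noncomputable def planeGcd {g : ℕ} (B : OpenGrassmannian g) : ℂ[X] :=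
  Submodule.IsPrincipal.generator (Ideal.span (B.1 : Set ℂ[X]))

/-! Every plane in the open Grassmannian is `{z u + conj z u*}`, where `u` has constant term 1 and
degree at most `g`, and `u*` is its conjugate reciprocal with respect to degree `g + 1`. The
coefficients `c ∈ ℂ^g` of `u` form a global analytic chart, `planeCoords`. The common divisors of
the plane are those of `u` and `u*`. As `u(0) = 1`, a number `a` is a common root exactly when `a`
and `1 / conj a` are both roots of `u`. So `R^g` becomes the set of `c` for which `u` has a
reciprocal pair of roots, and `S^g` the set where such a pair collapses to a point of the circle.

Smooth points: if the gcd has degree 1 on `S^g`, its root is a simple root of `u`, it continues to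
an analytic function `W(c)`, and no other pair appears nearby. The locus is then `|W|² = 1`, one
real equation. If the gcd has degree 2 off `S^g`, one root of the pair is simple, and the locus is
`u(1 / conj W) = 0`, one complex equation. Both equations are submersions.

Dimension: rescaling the cofactor of a minimal self-reciprocal divisor destroys all other pairs
(`frequently_isReciprocalGcd`), so the points with gcd of minimal degree are dense in `S^g` and in
`R^g \ S^g`. Smoothness is open in the locus and determines its dimension, so every smooth point has
dimension `2g - 1` on `S^g` and `2g - 2` off it.

Singular points: if `u` has two coprime factors `P` and `Q`, each of which forces membership in the
locus, then perturbations by multiples of `P` and of `Q` are tangent and together span `ℂ^g`. A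
smooth point would have dimension `2g` (`IsSmoothPointOfDim.dim_eq_of_isCoprime`), which is
impossible. A double root or double pair is first split by a small perturbation, which preserves
smoothness. -/

/-! ### Smooth points: invariance, tangent spaces, submersions. -/

section SmoothPoints

variable {E : Type*} [NormedAddCommGroup E] [NormedSpace ℝ E]
  {M : Type*} [TopologicalSpace M] [ChartedSpace E M]
  {E' : Type*} [NormedAddCommGroup E'] [NormedSpace ℝ E']
  {M' : Type*} [TopologicalSpace M'] [ChartedSpace E' M']
  {n : WithTop ℕ∞} {k : ℕ}

/-- Smooth points are preserved by diffeomorphisms. -/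
theorem IsSmoothPointOfDim.map [IsManifold 𝓘(ℝ, E) n M] [IsManifold 𝓘(ℝ, E') n M']
    (Θ : Diffeomorph 𝓘(ℝ, E) 𝓘(ℝ, E') M M' n) (Φ : E ≃L[ℝ] E') {A : Set M} {A' : Set M'} {x : M}
    (hA : ∀ y, y ∈ A ↔ Θ y ∈ A') (h : IsSmoothPointOfDim E n A k x) :
    IsSmoothPointOfDim E' n A' k (Θ x) := by
  obtain ⟨hx, e, he, hxe, F, hF, hiff⟩ := h
  rw [IsManifold.mem_maximalAtlas_iff_contMDiffOn] at he
  refine ⟨(hA x).1 hx,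
    (Θ.symm.toHomeomorph.toOpenPartialHomeomorph.trans e).trans
      Φ.toHomeomorph.toOpenPartialHomeomorph, ?_, ?_,
    F.map (Φ : E →ₗ[ℝ] E'), ?_, ?_⟩
  · rw [IsManifold.mem_maximalAtlas_iff_contMDiffOn]
    constructor
    · refine Φ.contDiff.contMDiff.comp_contMDiffOn
        (he.1.comp Θ.symm.contMDiff.contMDiffOn ?_)
      intro y hy
      simpa using hy
    · refine Θ.contMDiff.comp_contMDiffOn
        (he.2.comp Φ.symm.contDiff.contMDiff.contMDiffOn ?_)
      intro y hy
      simpa using hy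
  · simpa using hxe
  · rw [LinearEquiv.finrank_map_eq Φ.toLinearEquiv, hF]
  · intro y hy
    have hy' : Θ.symm y ∈ e.source := by simpa using hy
    have h1 := hA (Θ.symm y)
    rw [Θ.apply_symm_apply] at h1
    rw [← h1, hiff _ hy']
    simp

/-- The chart straightening `A` at `x` also serves at all nearby points of `A`. This permits testing
smoothness at perturbed points in better position. -/
theorem IsSmoothPointOfDim.eventually {A : Set M} {x : M} (h : IsSmoothPointOfDim E n A k x) :
    ∀ᶠ y in 𝓝 x, y ∈ A → IsSmoothPointOfDim E n A k y := by
  obtain ⟨hx, e, he, hxe, F, hF, hiff⟩ := h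
  filter_upwards [e.open_source.mem_nhds hxe] with y hy hyA
  exact ⟨hyA, e, he, hy, F, hF, hiff⟩

/-- The derivative of a curve contained in a linear subspace lies in this subspace. -/
theorem HasDerivAt.mem_submodule [FiniteDimensional ℝ E] {F : Submodule ℝ E} {γ : ℝ → E} {v : E}
    (hγ : HasDerivAt γ v 0) (hF : ∀ᶠ t in 𝓝 0, γ t ∈ F) : v ∈ F := by
  have h1 := hγ.tendsto_slope_zero
  refine F.closed_of_finiteDimensional.mem_of_tendsto h1 ?_
  filter_upwards [hF.filter_mono nhdsWithin_le_nhds] with t ht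
  have h0 : γ 0 ∈ F := hF.self_of_nhds
  simpa using F.smul_mem _ (F.sub_mem ht h0)

/-- The tangent space at a smooth point of a subset of a vector space, described by curves. -/
theorem IsSmoothPointOfDim.exists_tangentSpace [FiniteDimensional ℝ E] (hn : n ≠ 0) {A : Set E}
    {x : E} (h : IsSmoothPointOfDim E n A k x) :
    ∃ T : Submodule ℝ E, Module.finrank ℝ T = k ∧ ∀ v, v ∈ T ↔
      ∃ γ : ℝ → E, γ 0 = x ∧ HasDerivAt γ v 0 ∧ ∀ᶠ t in 𝓝 0, γ t ∈ A := by
  obtain ⟨hx, e, he, hxe, F, hF, hiff⟩ := h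
  rw [IsManifold.mem_maximalAtlas_iff_contMDiffOn, contMDiffOn_iff_contDiffOn,
    contMDiffOn_iff_contDiffOn] at he
  have hex : e x ∈ e.target := e.map_source hxe
  have d1 : HasFDerivAt e (fderiv ℝ e x) x :=
    (((he.1.contDiffAt (e.open_source.mem_nhds hxe)).differentiableAt hn)).hasFDerivAt
  have d2 : HasFDerivAt e.symm (fderiv ℝ e.symm (e x)) (e x) :=
    (((he.2.contDiffAt (e.open_target.mem_nhds hex)).differentiableAt hn)).hasFDerivAt
  set D := fderiv ℝ e x
  set D' := fderiv ℝ e.symm (e x)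
  have h12 : ∀ v, D' (D v) = v := by
    have h3 : HasFDerivAt (e.symm ∘ e) (D'.comp D) x := d2.comp x d1
    have h4 : HasFDerivAt (e.symm ∘ e) (ContinuousLinearMap.id ℝ E) x :=
      (hasFDerivAt_id x).congr_of_eventuallyEq (e.eventually_left_inverse hxe)
    exact fun v => DFunLike.congr_fun (h3.unique h4) v
  have h21 : ∀ v, D (D' v) = v := by
    have d1' : HasFDerivAt e D (e.symm (e x)) := by rwa [e.left_inv hxe]
    have h3 : HasFDerivAt (e ∘ e.symm) (D.comp D') (e x) := d1'.comp (e x) d2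
    have h4 : HasFDerivAt (e ∘ e.symm) (ContinuousLinearMap.id ℝ E) (e x) :=
      (hasFDerivAt_id (e x)).congr_of_eventuallyEq (e.eventually_right_inverse hex)
    exact fun v => DFunLike.congr_fun (h3.unique h4) v
  let Φ : E ≃ₗ[ℝ] E := LinearEquiv.ofLinearMap (D : E →ₗ[ℝ] E) (D' : E →ₗ[ℝ] E)
    (LinearMap.ext h21) (LinearMap.ext h12)
  -- The tangent space is the preimage of `F` under the derivative of the chart. Its vectors are
  -- velocities of pulled-back lines `e x + t f`, which stay in `F` because `e x ∈ F`.
  refine ⟨F.map (Φ.symm : E →ₗ[ℝ] E), ?_, fun v => ⟨?_, ?_⟩⟩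
  · rw [LinearEquiv.finrank_map_eq, hF]
  · rintro ⟨f, hf, rfl⟩
    change ∃ γ : ℝ → E, γ 0 = x ∧ HasDerivAt γ (D' f) 0 ∧ ∀ᶠ t in 𝓝 0, γ t ∈ A
    have hl : HasDerivAt (fun t : ℝ => e x + t • f) f 0 := by
      simpa using ((hasDerivAt_id (0 : ℝ)).smul_const f).const_add (e x)
    refine ⟨fun t => e.symm (e x + t • f), by simp [e.left_inv hxe], ?_, ?_⟩
    · have d2' : HasFDerivAt e.symm D' ((fun t : ℝ => e x + t • f) 0) := by simpa using d2
      exact d2'.comp_hasDerivAt 0 hl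
    · have : ∀ᶠ t in 𝓝 (0 : ℝ), e x + t • f ∈ e.target := by
        refine hl.continuousAt.eventually_mem (e.open_target.mem_nhds ?_)
        simpa using hex
      filter_upwards [this] with t ht
      rw [hiff _ (e.map_target ht), e.right_inv ht]
      exact F.add_mem ((hiff x hxe).1 hx) (F.smul_mem _ hf)
  · rintro ⟨γ, h0, hγ, hA⟩
    refine ⟨D v, ?_, h12 v⟩
    have d1' : HasFDerivAt e D (γ 0) := by rwa [h0]
    have hd := d1'.comp_hasDerivAt 0 hγ
    refine hd.mem_submodule ?_
    have : ∀ᶠ t in 𝓝 (0 : ℝ), γ t ∈ e.source := by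
      refine hγ.continuousAt.eventually_mem (e.open_source.mem_nhds ?_)
      rwa [h0]
    filter_upwards [this, hA] with t ht1 ht2
    exact (hiff _ ht1).1 ht2

/-- The description of the tangent space by curves does not mention the chart, so two charts give
the same space. -/
theorem IsSmoothPointOfDim.dim_unique [FiniteDimensional ℝ E] (hn : n ≠ 0) {A : Set E}
    {x : E} {l : ℕ} (h : IsSmoothPointOfDim E n A k x) (h' : IsSmoothPointOfDim E n A l x) :
    k = l := by
  obtain ⟨T, hT, hT'⟩ := h.exists_tangentSpace hn
  obtain ⟨S, hS, hS'⟩ := h'.exists_tangentSpace hn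
  have : T = S := by
    ext v
    rw [hT', hS']
  rw [← hT, ← hS, this]

/-- The zero set of an analytic submersion consists of smooth points. -/
theorem isSmoothPointOfDim_of_submersion [FiniteDimensional ℝ E] [FiniteDimensional ℝ E']
    {A : Set E} {x : E} {H : E → E'} {D : E →L[ℝ] E'} (hxA : x ∈ A) (hH : ContDiffAt ℝ ω H x)
    (hD : HasFDerivAt H D x) (hsurj : Function.Surjective D) (hA : ∀ᶠ y in 𝓝 x, y ∈ A ↔ H y = 0) :
    IsSmoothPointOfDim E n A (Module.finrank ℝ E - Module.finrank ℝ E') x := by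
  obtain ⟨s', hs'⟩ := (D : E →ₗ[ℝ] E').exists_rightInverse_of_surjective
    (LinearMap.range_eq_top.2 hsurj)
  let s : E' →L[ℝ] E := s'.toContinuousLinearMap
  have hs : ∀ w, D (s w) = w := fun w => DFunLike.congr_fun hs' w
  -- The component of `y` transverse to `ker D` is replaced by `H y`. Then `f` has derivative the
  -- identity at `x`, and `D (f y) = H y`, so `f` carries the zero set of `H` into `ker D`.
  let f : E → E := fun y => (y - s (D y)) + s (H y)
  have hf : ContDiffAt ℝ ω f x := by
    refine ContDiffAt.add (contDiffAt_id.sub (s.contDiff.contDiffAt.comp x D.contDiff.contDiffAt)) ?_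
    exact s.contDiff.contDiffAt.comp x hH
  have hf' : HasFDerivAt f ((ContinuousLinearEquiv.refl ℝ E : E ≃L[ℝ] E) : E →L[ℝ] E) x := by
    have := ((hasFDerivAt_id x).sub (s.hasFDerivAt.comp x (D.hasFDerivAt (x := x)))).add
      (s.hasFDerivAt.comp x hD)
    refine this.congr_fderiv ?_
    ext v
    simp
  let φ := hf.toOpenPartialHomeomorph f hf' (by simp)
  have hφx : x ∈ φ.source := hf.mem_toOpenPartialHomeomorph_source hf' (by simp)
  have hsymm : ContDiffAt ℝ ω φ.symm (φ x) := hf.to_localInverse hf' (by simp)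
  -- Analyticity at one point spreads to a neighbourhood, to which the chart is restricted; there it
  -- gives class `C^n` for every `n`.
  have e1 : ∀ᶠ y in 𝓝 x, ContDiffAt ℝ ω f y := hf.eventually (by simp)
  have e2 : ∀ᶠ y in 𝓝 (φ x), ContDiffAt ℝ ω φ.symm y := hsymm.eventually (by simp)
  have e3 := (φ.continuousAt hφx).eventually e2
  obtain ⟨O, hO, hOo, hxO⟩ := eventually_nhds_iff.1 (e1.and (e3.and hA))
  refine ⟨hxA, φ.restrOpen O hOo, ?_, ?_, LinearMap.ker (D : E →ₗ[ℝ] E'), ?_, ?_⟩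
  · rw [IsManifold.mem_maximalAtlas_iff_contMDiffOn, contMDiffOn_iff_contDiffOn,
      contMDiffOn_iff_contDiffOn]
    constructor
    · intro y hy
      have hy' : y ∈ φ.source ∩ O := by simpa using hy
      exact (((hO y hy'.2).1).of_le le_top).contDiffWithinAt
    · intro y hy
      have hy' : y ∈ φ.target ∩ φ.symm ⁻¹' O := by simpa using hy
      have h := (hO _ hy'.2).2.1
      rw [φ.right_inv hy'.1] at h
      exact (h.of_le le_top).contDiffWithinAt
  · simp [hφx, hxO]
  · have h1 := (D : E →ₗ[ℝ] E').finrank_range_add_finrank_ker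
    rw [LinearMap.range_eq_top.2 hsurj, finrank_top] at h1
    omega
  · intro y hy
    have hy' : y ∈ φ.source ∩ O := by simpa using hy
    rw [(hO y hy'.2).2.2]
    change H y = 0 ↔ D (f y) = 0
    simp [f, hs]

end SmoothPoints

/-! ### Conjugate reciprocals and polynomials with constant term 1. -/

/-- The conjugate reciprocal `λ ^ N * conj (f (1 / conj λ))` of a polynomial `f` of degree at most
`N`. -/
noncomputable def conjReflect (N : ℕ) (f : ℂ[X]) : ℂ[X] :=
  (f.map (starRingEnd ℂ)).reflect N

theorem conjReflect_coeff (N : ℕ) (f : ℂ[X]) {i : ℕ} (hi : i ≤ N) :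
    (conjReflect N f).coeff i = conj (f.coeff (N - i)) := by
  rw [conjReflect, Polynomial.coeff_reflect, Polynomial.revAt_le hi, Polynomial.coeff_map]

theorem conjReflect_conjReflect (N : ℕ) (f : ℂ[X]) : conjReflect N (conjReflect N f) = f := by
  rw [conjReflect, conjReflect, ← Polynomial.reflect_map, Polynomial.reflect_reflect,
    Polynomial.map_map]
  convert Polynomial.map_id
  ext z
  simp

theorem natDegree_conjReflect_le {N : ℕ} {f : ℂ[X]} (hf : f.natDegree ≤ N) :
    (conjReflect N f).natDegree ≤ N := by
  refine Polynomial.natDegree_reflect_le.trans (max_le le_rfl ?_)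
  exact Polynomial.natDegree_map_le.trans hf

theorem conjReflect_mul {f h : ℂ[X]} {N K : ℕ} (hf : f.natDegree ≤ N) (hh : h.natDegree ≤ K) :
    conjReflect (N + K) (f * h) = conjReflect N f * conjReflect K h := by
  rw [conjReflect, Polynomial.map_mul, Polynomial.reflect_mul _ _
    (Polynomial.natDegree_map_le.trans hf) (Polynomial.natDegree_map_le.trans hh)]
  rfl

theorem conjReflect_one_X_sub_C {a : ℂ} (ha : a ≠ 0) :
    conjReflect 1 (Polynomial.X - Polynomial.C a) =
      Polynomial.C (-conj a) * (Polynomial.X - Polynomial.C (conj a)⁻¹) := by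
  have ha' : conj a ≠ 0 := by simpa using ha
  simp only [conjReflect, Polynomial.map_sub, Polynomial.map_X, Polynomial.map_C,
    Polynomial.reflect_sub, Polynomial.reflect_one_X, Polynomial.reflect_C, pow_one, mul_sub,
    ← Polynomial.C_mul]
  rw [neg_mul, mul_inv_cancel₀ ha']
  simp
  ring

theorem eval_conjReflect {N : ℕ} {f : ℂ[X]} (hf : f.natDegree ≤ N) {a : ℂ} (ha : a ≠ 0) :
    (conjReflect N f).eval a = a ^ N * conj (f.eval (conj a)⁻¹) := by
  have : Invertible a⁻¹ := invertibleOfNonzero (inv_ne_zero ha)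
  have h := Polynomial.eval₂_reflect_mul_pow (RingHom.id ℂ) a⁻¹ N (f.map (starRingEnd ℂ))
    (Polynomial.natDegree_map_le.trans hf)
  rw [invOf_eq_inv, inv_inv, Polynomial.eval₂_id, Polynomial.eval₂_id] at h
  have h2 : Polynomial.eval a⁻¹ (f.map (starRingEnd ℂ)) = conj (f.eval (conj a)⁻¹) := by
    rw [Polynomial.eval_map, ← Polynomial.eval₂_at_apply]
    simp
  rw [← h2, ← h, conjReflect, inv_pow]
  field_simp

theorem conjReflect_dvd {N m : ℕ} {f r : ℂ[X]} (hf : f.natDegree ≤ N) (hr : r ∣ f)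
    (hf0 : f ≠ 0) (hm : r.natDegree = m) : conjReflect m r ∣ conjReflect N f := by
  obtain ⟨h, rfl⟩ := hr
  have hr0 : r ≠ 0 := left_ne_zero_of_mul hf0
  have hh0 : h ≠ 0 := right_ne_zero_of_mul hf0
  rw [Polynomial.natDegree_mul hr0 hh0] at hf
  have : N = m + (N - m) := by omega
  rw [this, conjReflect_mul hm.le (by omega)]
  exact dvd_mul_right _ _

theorem natDegree_X_sub_C_pow (a : ℂ) (m : ℕ) :
    ((Polynomial.X - Polynomial.C a) ^ m).natDegree = m := by
  rw [Polynomial.natDegree_pow, Polynomial.natDegree_X_sub_C, mul_one]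

theorem conjReflect_X_sub_C_pow {a : ℂ} (ha : a ≠ 0) (m : ℕ) :
    conjReflect m ((Polynomial.X - Polynomial.C a) ^ m) =
      Polynomial.C ((-conj a) ^ m) * (Polynomial.X - Polynomial.C (conj a)⁻¹) ^ m := by
  induction m with
  | zero => simp [conjReflect]
  | succ m ih =>
    rw [pow_succ, conjReflect_mul (natDegree_X_sub_C_pow a m).le
      (Polynomial.natDegree_X_sub_C a).le, ih, conjReflect_one_X_sub_C ha, pow_succ, pow_succ,
      Polynomial.C_mul]
    ring

/-- Reflection is multiplicative and turns `(X - a) ^ m` into a nonzero multiple of `(X - 1 / conj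
a) ^ m`; so it carries multiplicities of roots to the reciprocal points. -/
theorem X_sub_C_pow_dvd_conjReflect {N m : ℕ} {f : ℂ[X]} (hf : f.natDegree ≤ N) (hf0 : f ≠ 0)
    {a : ℂ} (ha : a ≠ 0) (h : (Polynomial.X - Polynomial.C a) ^ m ∣ f) :
    (Polynomial.X - Polynomial.C (conj a)⁻¹) ^ m ∣ conjReflect N f := by
  have h1 := conjReflect_dvd hf h hf0 (natDegree_X_sub_C_pow a m)
  rw [conjReflect_X_sub_C_pow ha] at h1
  exact dvd_of_mul_left_dvd h1

/-- The polynomial `1 + c_0 λ + ⋯ + c_{g-1} λ^g`. -/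
noncomputable def unitPoly {g : ℕ} (c : Fin g → ℂ) : ℂ[X] :=
  1 + ∑ k : Fin g, Polynomial.monomial (k + 1 : ℕ) (c k)

theorem unitPoly_coeff_zero {g : ℕ} (c : Fin g → ℂ) : (unitPoly c).coeff 0 = 1 := by
  simp [unitPoly, Polynomial.coeff_monomial]

theorem unitPoly_coeff_succ {g : ℕ} (c : Fin g → ℂ) (k : Fin g) :
    (unitPoly c).coeff (k + 1) = c k := by
  rw [unitPoly, Polynomial.coeff_add, Polynomial.finsetSum_coeff, Finset.sum_eq_single k]
  · simp [Polynomial.coeff_one]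
  · intro j _ hj
    rw [Polynomial.coeff_monomial, if_neg]
    exact fun h => hj (Fin.ext (by omega))
  · simp

theorem natDegree_unitPoly_le {g : ℕ} (c : Fin g → ℂ) : (unitPoly c).natDegree ≤ g := by
  refine Polynomial.natDegree_add_le_of_degree_le (by simp)
    (Polynomial.natDegree_sum_le_of_forall_le _ _ fun k _ => ?_)
  exact (Polynomial.natDegree_monomial_le _).trans k.2

theorem unitPoly_ne_zero {g : ℕ} (c : Fin g → ℂ) : unitPoly c ≠ 0 := by
  intro h
  have := unitPoly_coeff_zero c
  simp [h] at this

theorem eval_unitPoly {g : ℕ} (c : Fin g → ℂ) (w : ℂ) :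
    (unitPoly c).eval w = 1 + ∑ k : Fin g, c k * w ^ (k + 1 : ℕ) := by
  simp [unitPoly, Polynomial.eval_finsetSum]

/-- The coefficients of `λ, …, λ^g` of a polynomial. -/
noncomputable def coeffVec (g : ℕ) : ℂ[X] →ₗ[ℂ] (Fin g → ℂ) :=
  LinearMap.pi fun k => Polynomial.lcoeff ℂ (k + 1)

theorem coeffVec_apply (g : ℕ) (f : ℂ[X]) (k : Fin g) : coeffVec g f k = f.coeff (k + 1) := rfl

theorem unitPoly_coeffVec {g : ℕ} {f : ℂ[X]} (h0 : f.coeff 0 = 1) (hf : f.natDegree ≤ g) :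
    unitPoly (coeffVec g f) = f := by
  ext i
  rcases Nat.eq_zero_or_pos i with rfl | hi
  · rw [unitPoly_coeff_zero, h0]
  rcases le_or_gt i g with h | h
  · obtain ⟨k, rfl⟩ : ∃ k : Fin g, i = k + 1 := ⟨⟨i - 1, by omega⟩, by simp; omega⟩
    rw [unitPoly_coeff_succ, coeffVec_apply]
  · rw [Polynomial.coeff_eq_zero_of_natDegree_lt ((natDegree_unitPoly_le _).trans_lt h),
      Polynomial.coeff_eq_zero_of_natDegree_lt (hf.trans_lt h)]

theorem coeffVec_unitPoly {g : ℕ} (c : Fin g → ℂ) : coeffVec g (unitPoly c) = c :=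
  funext fun k => unitPoly_coeff_succ c k

/-- `D` is a greatest common divisor of `unitPoly c` and its conjugate reciprocal. -/
def IsReciprocalGcd {g : ℕ} (c : Fin g → ℂ) (D : ℂ[X]) : Prop :=
  ∀ r, r ∣ D ↔ r ∣ unitPoly c ∧ r ∣ conjReflect (g + 1) (unitPoly c)

/-- The parameters `c` for which `unitPoly c` and its conjugate reciprocal have a common root. -/
def reciprocalLocus (g : ℕ) : Set (Fin g → ℂ) :=
  {c | ∃ a, (unitPoly c).eval a = 0 ∧ (conjReflect (g + 1) (unitPoly c)).eval a = 0}

/-- The parameters `c` for which `unitPoly c` has a root on the unit circle. -/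
def unimodularLocus (g : ℕ) : Set (Fin g → ℂ) :=
  {c | ∃ w : ℂ, ‖w‖ = 1 ∧ (unitPoly c).eval w = 0}

/-! ### Complex coordinates on the open Grassmannian. -/

section Coordinates

/-- The real linear map `z ↦ z c + conj z c*` attached to a vector `c` of complex coefficients. -/
noncomputable def coeffsToMap (g : ℕ) (c : Fin g → ℂ) : ℂ →L[ℝ] midCoeffs g :=
  LinearMap.toContinuousLinearMap
    { toFun := fun z => ⟨fun k => z * c k + conj z * conj (c k.rev), fun k => by
        simp [add_comm]⟩
      map_add' := fun z w => by
        ext k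
        simp
        ring
      map_smul' := fun r z => by
        ext k
        simp
        ring }

theorem coeffsToMap_apply (g : ℕ) (c : Fin g → ℂ) (z : ℂ) (k : Fin g) :
    (coeffsToMap g c z).1 k = z * c k + conj z * conj (c k.rev) := rfl

/-- Complex coordinates on the space of linear maps whose graphs are the planes. -/
noncomputable def mapCoords (g : ℕ) : (ℂ →L[ℝ] midCoeffs g) ≃L[ℝ] (Fin g → ℂ) :=
  LinearEquiv.toContinuousLinearEquiv
    -- This is the complex linear part of `L`. The reality condition on middle coefficients makes
    -- the antilinear part its reversed conjugate, so no information is lost.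
    { toFun := fun L k => ((L 1).1 k - Complex.I * (L Complex.I).1 k) / 2
      map_add' := fun L M => by
        ext k
        simp
        ring
      map_smul' := fun r L => by
        ext k
        simp
        ring
      invFun := coeffsToMap g
      left_inv := fun L => by
        ext z k
        have h1 : L z = z.re • L 1 + z.im • L Complex.I := by
          rw [← map_smul, ← map_smul, ← map_add]
          congr 1
          simp
        have e1 := (L 1).2 k
        have e2 := (L Complex.I).2 k
        rw [coeffsToMap_apply, h1]
        simp only [e1, e2, Submodule.coe_add, Submodule.coe_smul, Pi.add_apply, Pi.smul_apply,
          Complex.real_smul, map_div₀, map_sub, map_mul, Complex.conj_conj, Complex.conj_I,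
          map_ofNat]
        apply Complex.ext <;> simp <;> ring
      right_inv := fun c => by
        ext k
        simp only [coeffsToMap_apply, map_one, Complex.conj_I]
        linear_combination (-(c k) / 2 + conj (c k.rev) / 2) * Complex.I_mul_I }

theorem assemble_coeffsToMap (g : ℕ) (c : Fin g → ℂ) (z : ℂ) :
    assemble g (z, coeffsToMap g c z) = Polynomial.C z * unitPoly c +
      Polynomial.C (conj z) * conjReflect (g + 1) (unitPoly c) := by
  have hdeg := natDegree_unitPoly_le c
  ext i
  rw [Polynomial.coeff_add, Polynomial.coeff_C_mul, Polynomial.coeff_C_mul]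
  rcases Nat.eq_zero_or_pos i with rfl | h0
  · rw [assemble_coeff_zero, unitPoly_coeff_zero, conjReflect_coeff _ _ (by omega),
      Polynomial.coeff_eq_zero_of_natDegree_lt (by omega)]
    simp
  rcases lt_trichotomy i (g + 1) with h1 | rfl | h1
  · obtain ⟨k, rfl⟩ : ∃ k : Fin g, i = k + 1 := ⟨⟨i - 1, by omega⟩, by simp; omega⟩
    rw [assemble_coeff_mid, coeffsToMap_apply, unitPoly_coeff_succ, conjReflect_coeff _ _ h1.le,
      show g + 1 - (k + 1 : ℕ) = (k.rev : ℕ) + 1 by rw [Fin.val_rev]; omega, unitPoly_coeff_succ]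
  · rw [assemble_coeff_last, conjReflect_coeff _ _ le_rfl, Nat.sub_self, unitPoly_coeff_zero,
      Polynomial.coeff_eq_zero_of_natDegree_lt (by omega)]
    simp
  · rw [Polynomial.coeff_eq_zero_of_natDegree_lt ((assemble_natDegree g _).trans_lt h1),
      Polynomial.coeff_eq_zero_of_natDegree_lt (by omega),
      Polynomial.coeff_eq_zero_of_natDegree_lt
        ((natDegree_conjReflect_le (hdeg.trans (Nat.le_succ g))).trans_lt h1)]
    simp

/-- The global chart of the open Grassmannian with values in `ℂ^g`. -/
noncomputable def planeCoords (g : ℕ) (n : WithTop ℕ∞) :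
    Diffeomorph 𝓘(ℝ, ℂ →L[ℝ] midCoeffs g) 𝓘(ℝ, Fin g → ℂ) (OpenGrassmannian g) (Fin g → ℂ) n where
  toEquiv := (graphChart g).toEquiv.trans (mapCoords g).toEquiv
  contMDiff_toFun := by
    have h0 : ContDiff ℝ n (mapCoords g) :=
      ContinuousLinearEquiv.contDiff (𝕜 := ℝ) (E := ℂ →L[ℝ] midCoeffs g) (F := Fin g → ℂ) (mapCoords g)
    refine h0.contMDiff.comp ?_
    have h : ContMDiffOn 𝓘(ℝ, ℂ →L[ℝ] midCoeffs g) 𝓘(ℝ, ℂ →L[ℝ] midCoeffs g) n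
        (graphChart g).toOpenPartialHomeomorph Set.univ :=
      contMDiffOn_of_mem_maximalAtlas (IsManifold.subset_maximalAtlas rfl)
    exact contMDiffOn_univ.1 h
  contMDiff_invFun := by
    have h : ContMDiffOn 𝓘(ℝ, ℂ →L[ℝ] midCoeffs g) 𝓘(ℝ, ℂ →L[ℝ] midCoeffs g) n
        (graphChart g).toOpenPartialHomeomorph.symm Set.univ :=
      contMDiffOn_symm_of_mem_maximalAtlas (IsManifold.subset_maximalAtlas rfl)
    have h0 : ContDiff ℝ n (mapCoords g).symm :=
      ContinuousLinearEquiv.contDiff (𝕜 := ℝ) (E := Fin g → ℂ) (F := ℂ →L[ℝ] midCoeffs g)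
        (mapCoords g).symm
    exact (contMDiffOn_univ.1 h).comp h0.contMDiff

theorem mem_plane_iff {g : ℕ} {n : WithTop ℕ∞} (B : OpenGrassmannian g) (b : ℂ[X]) :
    b ∈ B.1 ↔ ∃ z : ℂ, b = Polynomial.C z * unitPoly (planeCoords g n B) +
      Polynomial.C (conj z) * conjReflect (g + 1) (unitPoly (planeCoords g n B)) := by
  obtain ⟨L, rfl⟩ := (graphEquiv g).surjective B
  have hc : planeCoords g n (graphEquiv g L) = mapCoords g L :=
    congrArg (mapCoords g) ((graphEquiv g).symm_apply_apply L)
  rw [hc]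
  have hL : coeffsToMap g (mapCoords g L) = L := (mapCoords g).symm_apply_apply L
  simp_rw [← assemble_coeffsToMap, hL]
  constructor
  · rintro ⟨⟨z, c⟩, hv, rfl⟩
    have hv' : c = L z := hv
    exact ⟨z, by rw [hv']⟩
  · rintro ⟨z, rfl⟩
    exact ⟨(z, L z), rfl, rfl⟩

/-- The elements with `z = 1` and `z = I` are `u + v` and `I (u - v)`; over `ℂ` they generate both
`u` and `v`. -/
theorem forall_plane_dvd_iff {g : ℕ} {n : WithTop ℕ∞} (B : OpenGrassmannian g) (r : ℂ[X]) :
    (∀ b ∈ B.1, r ∣ b) ↔ r ∣ unitPoly (planeCoords g n B) ∧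
      r ∣ conjReflect (g + 1) (unitPoly (planeCoords g n B)) := by
  set u := unitPoly (planeCoords g n B)
  set v := conjReflect (g + 1) u
  have hmem := mem_plane_iff (n := n) B
  constructor
  · intro h
    have h1 := h _ ((hmem _).2 ⟨1, rfl⟩)
    have h2 := h _ ((hmem _).2 ⟨Complex.I, rfl⟩)
    have hI : (Polynomial.C Complex.I : ℂ[X]) * Polynomial.C Complex.I = -1 := by
      rw [← Polynomial.C_mul, Complex.I_mul_I]
      simp
    have h2' : (Polynomial.C (2⁻¹ : ℂ) : ℂ[X]) * 2 = 1 := by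
      rw [show (2 : ℂ[X]) = Polynomial.C 2 from rfl, ← Polynomial.C_mul]
      simp
    simp only [map_one, Complex.conj_I, Polynomial.C_neg, one_mul] at h1 h2
    constructor
    · have h3 := (h1.sub (h2.mul_left (Polynomial.C Complex.I))).mul_left (Polynomial.C (2⁻¹ : ℂ))
      convert h3 using 1
      linear_combination (-u) * h2' + Polynomial.C (2⁻¹ : ℂ) * (u - v) * hI
    · have h3 := (h1.add (h2.mul_left (Polynomial.C Complex.I))).mul_left (Polynomial.C (2⁻¹ : ℂ))
      convert h3 using 1
      linear_combination (-v) * h2' - Polynomial.C (2⁻¹ : ℂ) * (u - v) * hI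
  · rintro ⟨h1, h2⟩ b hb
    obtain ⟨z, rfl⟩ := (hmem b).1 hb
    exact (h1.mul_left _).add (h2.mul_left _)

theorem isReciprocalGcd_planeGcd {g : ℕ} (n : WithTop ℕ∞) (B : OpenGrassmannian g) :
    IsReciprocalGcd (planeCoords g n B) (planeGcd B) := by
  intro r
  rw [← forall_plane_dvd_iff, planeGcd, ← Ideal.span_singleton_le_span_singleton,
    Ideal.span_singleton_generator, Ideal.span_le]
  simp only [Set.subset_def, SetLike.mem_coe, Ideal.mem_span_singleton]

theorem mem_commonRootLocus_iff {g : ℕ} (n : WithTop ℕ∞) (B : OpenGrassmannian g) :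
    B ∈ commonRootLocus g ↔ planeCoords g n B ∈ reciprocalLocus g := by
  simp only [commonRootLocus, reciprocalLocus, Set.mem_ofPred_eq, ← Polynomial.IsRoot.def,
    ← Polynomial.dvd_iff_isRoot, forall_plane_dvd_iff (n := n)]

theorem eval_conjReflect_unitPoly_eq_zero_iff {g : ℕ} (c : Fin g → ℂ) {a : ℂ} (ha : a ≠ 0) :
    (conjReflect (g + 1) (unitPoly c)).eval a = 0 ↔ (unitPoly c).eval (conj a)⁻¹ = 0 := by
  rw [eval_conjReflect ((natDegree_unitPoly_le c).trans (Nat.le_succ g)) ha]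
  simp [ha]

theorem conj_inv_eq_self_iff {a : ℂ} (ha : a ≠ 0) : (conj a)⁻¹ = a ↔ ‖a‖ = 1 := by
  rw [inv_eq_iff_eq_inv, ← mul_eq_one_iff_eq_inv₀ ha, mul_comm, Complex.mul_conj, Complex.normSq_eq_norm_sq]
  norm_cast
  exact pow_eq_one_iff_of_nonneg (norm_nonneg a) two_ne_zero

/-- On the circle `1 / conj w = w`, so the root condition on the reflected polynomial repeats the
one on `unitPoly`. -/
theorem mem_circleRootLocus_iff {g : ℕ} (n : WithTop ℕ∞) (B : OpenGrassmannian g) :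
    B ∈ circleRootLocus g ↔ planeCoords g n B ∈ unimodularLocus g := by
  simp only [circleRootLocus, rootLocusAt, unimodularLocus, Set.mem_iUnion, Set.mem_ofPred_eq,
    mem_sphere_zero_iff_norm, exists_prop, ← Polynomial.IsRoot.def,
    ← Polynomial.dvd_iff_isRoot, forall_plane_dvd_iff (n := n)]
  refine exists_congr fun w => and_congr_right fun hw => ?_
  have hw0 : w ≠ 0 := by
    rintro rfl
    simp at hw
  rw [Polynomial.dvd_iff_isRoot, Polynomial.dvd_iff_isRoot, Polynomial.IsRoot.def,
    Polynomial.IsRoot.def, eval_conjReflect_unitPoly_eq_zero_iff _ hw0,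
    (conj_inv_eq_self_iff hw0).2 hw, and_self]

theorem isSmoothPointOfDim_iff_planeCoords {g : ℕ} {n : WithTop ℕ∞} (k : ℕ)
    (B : OpenGrassmannian g) :
    IsSmoothPointOfDim (ℂ →L[ℝ] midCoeffs g) n (commonRootLocus g) k B ↔
      IsSmoothPointOfDim (Fin g → ℂ) n (reciprocalLocus g) k (planeCoords g n B) := by
  constructor
  · exact fun h => h.map _ (mapCoords g) (mem_commonRootLocus_iff n)
  · intro h
    have h1 := h.map (planeCoords g n).symm (mapCoords g).symm (A' := commonRootLocus g)
      (fun y => by rw [mem_commonRootLocus_iff n, (planeCoords g n).apply_symm_apply])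
    rwa [(planeCoords g n).symm_apply_apply] at h1

theorem hasLocalDim_iff_planeCoords {g : ℕ} {n : WithTop ℕ∞} (k : ℕ) (B : OpenGrassmannian g) :
    HasLocalDim (ℂ →L[ℝ] midCoeffs g) n (commonRootLocus g) B k ↔
      HasLocalDim (Fin g → ℂ) n (reciprocalLocus g) (planeCoords g n B) k := by
  have h := (planeCoords g n).toHomeomorph.map_nhds_eq B
  simp only [Diffeomorph.coe_toHomeomorph] at h
  rw [HasLocalDim, HasLocalDim, ← h, frequently_map, eventually_map]
  simp only [isSmoothPointOfDim_iff_planeCoords]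

end Coordinates

/-! ### Reciprocal pairs of roots and their deformation. -/

section ReciprocalRoots

variable {g : ℕ}

theorem eval_unitPoly_zero (c : Fin g → ℂ) : (unitPoly c).eval 0 = 1 := by
  rw [← Polynomial.coeff_zero_eq_eval_zero, unitPoly_coeff_zero]

theorem ne_zero_of_eval_unitPoly {c : Fin g → ℂ} {a : ℂ} (ha : (unitPoly c).eval a = 0) :
    a ≠ 0 := by
  rintro rfl
  simp [eval_unitPoly_zero] at ha

theorem mem_reciprocalLocus_iff {c : Fin g → ℂ} : c ∈ reciprocalLocus g ↔
    ∃ a, (unitPoly c).eval a = 0 ∧ (unitPoly c).eval (conj a)⁻¹ = 0 :=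
  exists_congr fun _ => and_congr_right fun ha =>
    eval_conjReflect_unitPoly_eq_zero_iff c (ne_zero_of_eval_unitPoly ha)

theorem unimodularLocus_subset : unimodularLocus g ⊆ reciprocalLocus g := by
  rintro c ⟨w, hw, h⟩
  refine mem_reciprocalLocus_iff.2 ⟨w, h, ?_⟩
  rwa [(conj_inv_eq_self_iff (ne_zero_of_eval_unitPoly h)).2 hw]

theorem contDiff_eval_unitPoly {𝕜 : Type*} [RCLike 𝕜] [NormedAlgebra 𝕜 ℂ] :
    ContDiff 𝕜 ω fun p : (Fin g → ℂ) × ℂ => (unitPoly p.1).eval p.2 := by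
  simp only [eval_unitPoly]
  refine contDiff_const.add (ContDiff.sum fun k _ => ContDiff.mul ?_ (contDiff_snd.pow _))
  exact (contDiff_apply 𝕜 ℂ k).comp contDiff_fst

theorem continuous_eval_unitPoly :
    Continuous fun p : (Fin g → ℂ) × ℂ => (unitPoly p.1).eval p.2 :=
  (contDiff_eval_unitPoly (𝕜 := ℂ)).continuous

theorem continuousAt_conj_inv {a : ℂ} (ha : a ≠ 0) : ContinuousAt (fun z : ℂ => (conj z)⁻¹) a :=
  Complex.continuous_conj.continuousAt.inv₀ (by simpa using ha)

theorem conj_inv_conj_inv (a : ℂ) : (conj (conj a)⁻¹)⁻¹ = a := by simp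

/-- A simple root of `unitPoly c` depends analytically on `c`. -/
theorem exists_root_function {c₀ : Fin g → ℂ} {w₀ : ℂ} (h0 : (unitPoly c₀).eval w₀ = 0)
    (h1 : (unitPoly c₀).derivative.eval w₀ ≠ 0) :
    ∃ W : (Fin g → ℂ) → ℂ, ContDiffAt ℝ ω W c₀ ∧ W c₀ = w₀ ∧
      (∀ᶠ c in 𝓝 c₀, (unitPoly c).eval (W c) = 0) ∧
      ∃ N ∈ 𝓝 w₀, ∀ᶠ c in 𝓝 c₀, ∀ w ∈ N, (unitPoly c).eval w = 0 → W c = w := by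
  set f : (Fin g → ℂ) × ℂ → ℂ := fun p => (unitPoly p.1).eval p.2 with hf
  have cdf : ContDiffAt ℂ ω f (c₀, w₀) := contDiff_eval_unitPoly.contDiffAt
  have hω : (ω : WithTop ℕ∞) ≠ 0 := by simp
  have hinv : (fderiv ℂ f (c₀, w₀) ∘L .inr ℂ (Fin g → ℂ) ℂ).IsInvertible := by
    have hd := (cdf.differentiableAt hω).hasFDerivAt
    have hc : HasFDerivAt (fun w => f (c₀, w)) (fderiv ℂ f (c₀, w₀) ∘L .inr ℂ (Fin g → ℂ) ℂ) w₀ :=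
      HasFDerivAt.comp w₀ hd (hasFDerivAt_prodMk_right c₀ w₀)
    have hp : HasDerivAt (fun w => f (c₀, w)) ((unitPoly c₀).derivative.eval w₀) w₀ :=
      (unitPoly c₀).hasDerivAt w₀
    rw [hc.unique hp.hasFDerivAt]
    refine ⟨ContinuousLinearEquiv.unitsEquivAut ℂ (Units.mk0 _ h1), ?_⟩
    ext
    simp
  refine ⟨cdf.implicitFunction hω hinv, ?_, cdf.implicitFunction_apply_self hω hinv, ?_, ?_⟩
  · exact (cdf.contDiffAt_implicitFunction hω hinv).restrict_scalars ℝ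
  · filter_upwards [cdf.eventually_apply_implicitFunction hω hinv] with c hc
    exact hc.trans h0
  · have h := cdf.eventually_apply_eq_iff_implicitFunction hω hinv
    rw [nhds_prod_eq, eventually_prod_iff] at h
    obtain ⟨p, hp, q, hq, hpq⟩ := h
    refine ⟨{w | q w}, hq, ?_⟩
    filter_upwards [hp] with c hc w hw hcw
    exact (hpq hc hw).1 (hcw.trans h0.symm)

/-- Pairs of reciprocal roots cannot appear suddenly. -/
theorem eventually_reciprocal_roots_mem {c₀ : Fin g → ℂ} {b₀ : ℂ} (hb₀ : b₀ ≠ 0)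
    (h : ∀ a, (unitPoly c₀).eval a = 0 → (unitPoly c₀).eval (conj a)⁻¹ = 0 →
      a = b₀ ∨ a = (conj b₀)⁻¹) {N : Set ℂ} (hN : N ∈ 𝓝 b₀) :
    ∀ᶠ c in 𝓝 c₀, ∀ a, (unitPoly c).eval a = 0 → (unitPoly c).eval (conj a)⁻¹ = 0 →
      a ∈ N ∨ (conj a)⁻¹ ∈ N := by
  -- Each reciprocal pair has a member in the closed unit disc, so compactness of the disc suffices
  -- even if roots escape to infinity. The discontinuity of `1 / conj a` at 0 is harmless, as
  -- `unitPoly` is 1 there.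
  have key : ∀ᶠ c in 𝓝 c₀, ∀ a ∈ Metric.closedBall (0 : ℂ) 1,
      ((unitPoly c).eval a = 0 → (unitPoly c).eval (conj a)⁻¹ = 0 → a ∈ N ∨ (conj a)⁻¹ ∈ N) := by
    refine (isCompact_closedBall (0 : ℂ) 1).eventually_forall_of_forall_eventually fun y _ => ?_
    by_cases hy : (unitPoly c₀).eval y = 0
    · have hy0 := ne_zero_of_eval_unitPoly hy
      have hcont : ContinuousAt (fun p : (Fin g → ℂ) × ℂ => (p.1, (conj p.2)⁻¹)) (c₀, y) :=
        continuousAt_fst.prodMk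
          (ContinuousAt.comp (f := Prod.snd) (continuousAt_conj_inv hy0) continuousAt_snd)
      by_cases hy' : (unitPoly c₀).eval (conj y)⁻¹ = 0
      · rcases h y hy hy' with rfl | rfl
        · filter_upwards [continuousAt_snd.eventually hN] with p hp _ _
          exact Or.inl hp
        · have hN' : ∀ᶠ z in 𝓝 (conj (conj b₀)⁻¹)⁻¹, z ∈ N := by
            rwa [conj_inv_conj_inv]
          filter_upwards [(continuousAt_snd.comp hcont).eventually hN'] with p hp _ _
          exact Or.inr hp
      · have hc2 := (continuous_eval_unitPoly (g := g)).continuousAt.comp hcont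
        filter_upwards [hc2.eventually_ne hy'] with p hp _ hp'
        exact absurd hp' hp
    · have hc2 := (continuous_eval_unitPoly (g := g)).continuousAt (x := (c₀, y))
      filter_upwards [hc2.eventually_ne hy] with p hp hp'
      exact absurd hp' hp
  filter_upwards [key] with c hc a ha ha'
  rcases le_total ‖a‖ 1 with h1 | h1
  · exact hc a (by simpa using h1) ha ha'
  · have := hc (conj a)⁻¹ (by simpa using inv_le_one_of_one_le₀ h1) ha'
      (by rwa [conj_inv_conj_inv])
    rw [conj_inv_conj_inv] at this
    exact this.symm

theorem isClosed_unimodularLocus : IsClosed (unimodularLocus g) := by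
  rw [← isOpen_compl_iff, isOpen_iff_eventually]
  intro c₀ hc₀
  have key : ∀ᶠ c in 𝓝 c₀, ∀ a ∈ Metric.sphere (0 : ℂ) 1, (unitPoly c).eval a ≠ 0 := by
    refine (isCompact_sphere (0 : ℂ) 1).eventually_forall_of_forall_eventually fun y hy => ?_
    have hc := (continuous_eval_unitPoly (g := g)).continuousAt (x := (c₀, y))
    refine hc.eventually_ne ?_
    exact fun h => hc₀ ⟨y, by simpa using hy, h⟩
  filter_upwards [key] with c hc
  rintro ⟨w, hw, h⟩
  exact hc w (by simpa using hw) h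

theorem finrank_coeffs : Module.finrank ℝ (Fin g → ℂ) = 2 * g := by
  rw [Module.finrank_pi_fintype]
  simp [mul_comm]

theorem unitPoly_add_coeffVec (c : Fin g → ℂ) {f : ℂ[X]} (h0 : f.coeff 0 = 0)
    (hf : f.natDegree ≤ g) : unitPoly (c + coeffVec g f) = unitPoly c + f := by
  rw [← unitPoly_coeffVec (f := unitPoly c + f) (g := g), map_add, coeffVec_unitPoly]
  · rw [Polynomial.coeff_add, unitPoly_coeff_zero, h0, add_zero]
  · exact Polynomial.natDegree_add_le_of_degree_le (natDegree_unitPoly_le c) hf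

/-! ### Local equations at points with a single pair. -/

/-- A simple root on the unit circle is a smooth point if there is no other pair of reciprocal
roots. -/
theorem isSmoothPointOfDim_of_unimodular_root {n : WithTop ℕ∞} {c₀ : Fin g → ℂ} {w₀ : ℂ}
    (hw₀ : ‖w₀‖ = 1)
    (h0 : (unitPoly c₀).eval w₀ = 0) (h1 : (unitPoly c₀).derivative.eval w₀ ≠ 0)
    (huniq : ∀ a, (unitPoly c₀).eval a = 0 → (unitPoly c₀).eval (conj a)⁻¹ = 0 → a = w₀) :
    IsSmoothPointOfDim (Fin g → ℂ) n (reciprocalLocus g) (2 * g - 1) c₀ := by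
  obtain ⟨W, hW, hW0, hWroot, N, hN, hWuniq⟩ := exists_root_function h0 h1
  have hw0 : w₀ ≠ 0 := ne_zero_of_eval_unitPoly h0
  have hself := (conj_inv_eq_self_iff hw0).2 hw₀
  -- With both members of a nearby pair in `N`, uniqueness of the root `W c` in `N` identifies them,
  -- which forces the root onto the circle.
  have hN' : N ∩ {a | (conj a)⁻¹ ∈ N} ∈ 𝓝 w₀ := by
    refine inter_mem hN ((continuousAt_conj_inv hw0).eventually ?_)
    simp only [hself]
    exact hN
  have hnear := eventually_reciprocal_roots_mem hw0
    (fun a ha ha' => Or.inl (huniq a ha ha')) hN'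
  let H : (Fin g → ℂ) → ℝ := fun c => ‖W c‖ ^ 2 - 1
  have hH : ContDiffAt ℝ ω H c₀ := (hW.norm_sq ℝ).sub contDiffAt_const
  have hD := (hH.differentiableAt (by simp)).hasFDerivAt
  rw [← finrank_coeffs, ← Module.finrank_self ℝ]
  refine isSmoothPointOfDim_of_submersion (unimodularLocus_subset ⟨w₀, hw₀, h0⟩) hH hD ?_ ?_
  -- The curve replaces `u(λ)` by `u((1 + t)λ)`, which moves the root to `w₀ / (1 + t)`. Hence `H`
  -- becomes `(1 + t)⁻² - 1`, with derivative `-2` at 0.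
  · let γ : ℝ → Fin g → ℂ := fun t k => ((1 + t : ℝ) : ℂ) ^ (k + 1 : ℕ) * c₀ k
    have hγ : ∀ t w, (unitPoly (γ t)).eval w = (unitPoly c₀).eval (((1 + t : ℝ) : ℂ) * w) := by
      intro t w
      simp only [eval_unitPoly, γ, mul_pow]
      congr 1
      exact Finset.sum_congr rfl fun k _ => by ring
    have hγ0 : γ 0 = c₀ := by
      ext k
      simp [γ]
    have hγd : DifferentiableAt ℝ γ 0 := by
      rw [differentiableAt_pi]
      intro k
      refine DifferentiableAt.mul_const (DifferentiableAt.pow ?_ _) _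
      exact Complex.ofRealCLM.differentiableAt.comp (0 : ℝ) (differentiableAt_id.const_add 1)
    have hHγ : HasDerivAt (H ∘ γ) (fderiv ℝ H c₀ (deriv γ 0)) 0 := by
      have hD' : HasFDerivAt H (fderiv ℝ H c₀) (γ 0) := by rwa [hγ0]
      exact hD'.comp_hasDerivAt 0 hγd.hasDerivAt
    have hHeq : H ∘ γ =ᶠ[𝓝 0] fun t : ℝ => ((1 + t) ^ 2)⁻¹ - 1 := by
      have e1 : ∀ᶠ t in 𝓝 (0 : ℝ), ∀ w ∈ N, (unitPoly (γ t)).eval w = 0 → W (γ t) = w := by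
        have hWuniq' := hWuniq
        rw [← hγ0] at hWuniq'
        exact hγd.continuousAt.eventually hWuniq'
      have e2 : ∀ᶠ t in 𝓝 (0 : ℝ), (((1 + t : ℝ) : ℂ))⁻¹ * w₀ ∈ N := by
        have hc : ContinuousAt (fun t : ℝ => (((1 + t : ℝ) : ℂ))⁻¹ * w₀) 0 := by
          refine ContinuousAt.mul (ContinuousAt.inv₀ (by fun_prop) (by simp)) continuousAt_const
        refine hc.eventually ?_
        simpa using hN
      have e3 : ∀ᶠ t in 𝓝 (0 : ℝ), 1 + t ≠ 0 :=
        ContinuousAt.eventually_ne (by fun_prop) (by simp)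
      filter_upwards [e1, e2, e3] with t h1 h2 h3
      have h3' : ((1 + t : ℝ) : ℂ) ≠ 0 := by exact_mod_cast h3
      have := h1 _ h2 (by rw [hγ, mul_inv_cancel_left₀ h3', h0])
      simp only [Function.comp_apply, H, this, norm_mul, norm_inv, hw₀, mul_one,
        Complex.norm_real, inv_pow, Real.norm_eq_abs, sq_abs]
    have hd2 : HasDerivAt (fun t : ℝ => ((1 + t) ^ 2)⁻¹ - 1) (-2) 0 := by
      have := ((((hasDerivAt_id (0 : ℝ)).const_add 1).pow 2).inv (by simp)).sub_const 1
      simpa using this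
    have hval : fderiv ℝ H c₀ (deriv γ 0) = -2 :=
      hHγ.unique (hd2.congr_of_eventuallyEq hHeq)
    intro y
    refine ⟨(-y / 2) • deriv γ 0, ?_⟩
    rw [map_smul, hval, smul_eq_mul]
    ring
  · filter_upwards [hWroot, hWuniq, hnear] with c hc1 hc2 hc3
    have hiff : H c = 0 ↔ ‖W c‖ = 1 := by
      rw [sub_eq_zero, pow_eq_one_iff_of_nonneg (norm_nonneg _) two_ne_zero]
    rw [hiff]
    constructor
    · intro hc
      obtain ⟨a, ha, ha'⟩ := mem_reciprocalLocus_iff.1 hc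
      have hN2 : a ∈ N ∧ (conj a)⁻¹ ∈ N := by
        rcases hc3 a ha ha' with h | h
        · exact h
        · refine ⟨?_, h.1⟩
          simpa using h.2
      have hWa := hc2 a hN2.1 ha
      have hWa' := hc2 _ hN2.2 ha'
      rw [hWa]
      exact (conj_inv_eq_self_iff (ne_zero_of_eval_unitPoly ha)).1 (hWa'.symm.trans hWa)
    · exact fun h => unimodularLocus_subset ⟨W c, h, hc1⟩

/-- A simple root off the unit circle is a smooth point if its reciprocal is a root and if there
is no other pair of reciprocal roots. -/
theorem isSmoothPointOfDim_of_reciprocal_roots {n : WithTop ℕ∞} {c₀ : Fin g → ℂ} {b₀ : ℂ}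
    (hb₀ : ‖b₀‖ ≠ 1)
    (h0 : (unitPoly c₀).eval b₀ = 0) (h0' : (unitPoly c₀).eval (conj b₀)⁻¹ = 0)
    (h1 : (unitPoly c₀).derivative.eval b₀ ≠ 0) (hg : 2 ≤ g)
    (huniq : ∀ a, (unitPoly c₀).eval a = 0 → (unitPoly c₀).eval (conj a)⁻¹ = 0 →
      a = b₀ ∨ a = (conj b₀)⁻¹) :
    IsSmoothPointOfDim (Fin g → ℂ) n (reciprocalLocus g) (2 * g - 2) c₀ := by
  obtain ⟨W, hW, hW0, hWroot, N, hN, hWuniq⟩ := exists_root_function h0 h1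
  have hb0 : b₀ ≠ 0 := ne_zero_of_eval_unitPoly h0
  have hb0' : conj b₀ ≠ 0 := by simpa using hb0
  have hne : (conj b₀)⁻¹ - b₀ ≠ 0 := by
    rw [sub_ne_zero]
    exact fun h => hb₀ ((conj_inv_eq_self_iff hb0).1 h)
  have hnear := eventually_reciprocal_roots_mem hb0 huniq hN
  let H : (Fin g → ℂ) → ℂ := fun c => (unitPoly c).eval (conj (W c))⁻¹
  have hH : ContDiffAt ℝ ω H c₀ := by
    have h2 : ContDiffAt ℝ ω (fun c => (conj (W c))⁻¹) c₀ := by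
      refine ContDiffAt.inv ?_ (by rwa [hW0])
      exact Complex.conjCLE.contDiff.contDiffAt.comp c₀ hW
    exact (contDiff_eval_unitPoly (g := g) (𝕜 := ℝ)).contDiffAt.comp c₀ (contDiffAt_id.prodMk h2)
  have hD := (hH.differentiableAt (by simp)).hasFDerivAt
  rw [← finrank_coeffs, ← Complex.finrank_real_complex]
  refine isSmoothPointOfDim_of_submersion (mem_reciprocalLocus_iff.2 ⟨b₀, h0, h0'⟩) hH hD ?_ ?_
  · intro η
    -- Adding a multiple of `X (X - b₀)` keeps the constant term and the root `b₀`, so `W` stays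
    -- fixed; `κ` is chosen so that the value at `1 / conj b₀` is `η`.
    let κ : ℂ := η / ((conj b₀)⁻¹ * ((conj b₀)⁻¹ - b₀))
    let f : ℂ[X] := Polynomial.C κ * (Polynomial.X * (Polynomial.X - Polynomial.C b₀))
    have hfdeg : f.natDegree ≤ 2 := by
      refine (Polynomial.natDegree_C_mul_le _ _).trans (Polynomial.natDegree_mul_le.trans ?_)
      simp
    refine ⟨coeffVec g f, ?_⟩
    have hpoly : ∀ t : ℝ, unitPoly (c₀ + t • coeffVec g f) =
        unitPoly c₀ + Polynomial.C (t : ℂ) * f := by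
      intro t
      rw [← unitPoly_add_coeffVec]
      · congr 2
        ext k
        simp [coeffVec_apply]
      · simp [f]
      · exact (Polynomial.natDegree_C_mul_le _ _).trans (hfdeg.trans hg)
    have hl : HasDerivAt (fun t : ℝ => c₀ + t • coeffVec g f) (coeffVec g f) 0 := by
      simpa using ((hasDerivAt_id (0 : ℝ)).smul_const (coeffVec g f)).const_add c₀
    have hHγ : HasDerivAt (fun t : ℝ => H (c₀ + t • coeffVec g f))
        (fderiv ℝ H c₀ (coeffVec g f)) 0 := by
      have hD' : HasFDerivAt H (fderiv ℝ H c₀) ((fun t : ℝ => c₀ + t • coeffVec g f) 0) := by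
        simpa using hD
      exact hD'.comp_hasDerivAt 0 hl
    have hHeq : (fun t : ℝ => H (c₀ + t • coeffVec g f)) =ᶠ[𝓝 0] fun t : ℝ => t • η := by
      have e1 : ∀ᶠ t in 𝓝 (0 : ℝ), ∀ w ∈ N, (unitPoly (c₀ + t • coeffVec g f)).eval w = 0 →
          W (c₀ + t • coeffVec g f) = w := by
        have hlim := hl.continuousAt.tendsto
        simp only [zero_smul, add_zero] at hlim
        exact hlim.eventually hWuniq
      filter_upwards [e1] with t ht
      have hWt := ht b₀ (mem_of_mem_nhds hN) (by rw [hpoly]; simp [h0, f])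
      simp only [H, hWt, hpoly, Polynomial.eval_add, h0', f, Polynomial.eval_mul,
        Polynomial.eval_C, Polynomial.eval_sub, Polynomial.eval_X, zero_add, κ,
        Complex.real_smul]
      rw [div_mul_cancel₀ _ (mul_ne_zero (inv_ne_zero hb0') hne)]
    have hd2 : HasDerivAt (fun t : ℝ => t • η) η 0 := by
      simpa using (hasDerivAt_id (0 : ℝ)).smul_const η
    exact hHγ.unique (hd2.congr_of_eventuallyEq hHeq)
  · filter_upwards [hWroot, hWuniq, hnear] with c hc1 hc2 hc3
    constructor
    · intro hc
      obtain ⟨a, ha, ha'⟩ := mem_reciprocalLocus_iff.1 hc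
      rcases hc3 a ha ha' with h | h
      · change (unitPoly c).eval (conj (W c))⁻¹ = 0
        rwa [hc2 a h ha]
      · change (unitPoly c).eval (conj (W c))⁻¹ = 0
        rwa [hc2 _ h ha', conj_inv_conj_inv]
    · exact fun h => mem_reciprocalLocus_iff.2 ⟨W c, hc1, h⟩

/-! ### Divisors attached to pairs, and the gcd. -/

/-- The polynomial with the simple roots `a` and `1 / conj a`. -/
noncomputable def pairPoly (a : ℂ) : ℂ[X] :=
  (Polynomial.X - Polynomial.C a) * (Polynomial.X - Polynomial.C (conj a)⁻¹)

theorem pairPoly_monic (a : ℂ) : (pairPoly a).Monic :=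
  (Polynomial.monic_X_sub_C _).mul (Polynomial.monic_X_sub_C _)

theorem natDegree_pairPoly (a : ℂ) : (pairPoly a).natDegree = 2 := by
  rw [pairPoly, Polynomial.natDegree_mul (Polynomial.X_sub_C_ne_zero _)
    (Polynomial.X_sub_C_ne_zero _), Polynomial.natDegree_X_sub_C, Polynomial.natDegree_X_sub_C]

theorem isCoprime_X_sub_C {a b : ℂ} (h : a ≠ b) :
    IsCoprime (Polynomial.X - Polynomial.C a) (Polynomial.X - Polynomial.C b) :=
  Polynomial.isCoprime_X_sub_C_of_isUnit_sub (sub_ne_zero.2 h).isUnit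

theorem isCoprime_X_sub_C_pairPoly {w a : ℂ} (h : w ≠ a) (h' : w ≠ (conj a)⁻¹) :
    IsCoprime (Polynomial.X - Polynomial.C w) (pairPoly a) :=
  (isCoprime_X_sub_C h).mul_right (isCoprime_X_sub_C h')

theorem isCoprime_pairPoly {a b : ℂ} (h : a ≠ b) (h' : a ≠ (conj b)⁻¹) :
    IsCoprime (pairPoly a) (pairPoly b) := by
  refine (isCoprime_X_sub_C_pairPoly h h').mul_left (isCoprime_X_sub_C_pairPoly ?_ ?_)
  · intro h1
    exact h' (by rw [← h1, conj_inv_conj_inv])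
  · intro h1
    exact h (by rw [← conj_inv_conj_inv a, h1, conj_inv_conj_inv])

theorem X_sub_C_dvd_unitPoly_iff {c : Fin g → ℂ} {a : ℂ} :
    Polynomial.X - Polynomial.C a ∣ unitPoly c ↔ (unitPoly c).eval a = 0 :=
  Polynomial.dvd_iff_isRoot

theorem conj_inv_ne_self {a : ℂ} (ha : a ≠ 0) (h : ‖a‖ ≠ 1) : (conj a)⁻¹ ≠ a :=
  fun h1 => h ((conj_inv_eq_self_iff ha).1 h1)

theorem pairPoly_dvd_unitPoly {c : Fin g → ℂ} {a : ℂ} (h : ‖a‖ ≠ 1)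
    (ha : (unitPoly c).eval a = 0) (ha' : (unitPoly c).eval (conj a)⁻¹ = 0) :
    pairPoly a ∣ unitPoly c :=
  (isCoprime_X_sub_C (conj_inv_ne_self (ne_zero_of_eval_unitPoly ha) h).symm).mul_dvd
    (X_sub_C_dvd_unitPoly_iff.2 ha) (X_sub_C_dvd_unitPoly_iff.2 ha')

theorem mem_reciprocalLocus_of_pairPoly_dvd {c : Fin g → ℂ} {a : ℂ} (h : pairPoly a ∣ unitPoly c) :
    c ∈ reciprocalLocus g :=
  mem_reciprocalLocus_iff.2 ⟨a, X_sub_C_dvd_unitPoly_iff.1 (dvd_of_mul_right_dvd h),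
    X_sub_C_dvd_unitPoly_iff.1 (dvd_of_mul_left_dvd h)⟩

theorem mem_reciprocalLocus_of_X_sub_C_dvd {c : Fin g → ℂ} {w : ℂ} (hw : ‖w‖ = 1)
    (h : Polynomial.X - Polynomial.C w ∣ unitPoly c) : c ∈ reciprocalLocus g :=
  unimodularLocus_subset ⟨w, hw, X_sub_C_dvd_unitPoly_iff.1 h⟩

theorem natDegree_le_of_dvd_unitPoly {c : Fin g → ℂ} {r : ℂ[X]} (h : r ∣ unitPoly c) :
    r.natDegree ≤ g :=
  (Polynomial.natDegree_le_of_dvd h (unitPoly_ne_zero c)).trans (natDegree_unitPoly_le c)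

theorem X_sub_C_pow_dvd_conjReflect_unitPoly {c : Fin g → ℂ} {a : ℂ} {m : ℕ} (ha : a ≠ 0)
    (h : (Polynomial.X - Polynomial.C a) ^ m ∣ unitPoly c) :
    (Polynomial.X - Polynomial.C (conj a)⁻¹) ^ m ∣ conjReflect (g + 1) (unitPoly c) :=
  X_sub_C_pow_dvd_conjReflect ((natDegree_unitPoly_le c).trans (Nat.le_succ g))
    (unitPoly_ne_zero c) ha h

theorem X_sub_C_pow_dvd_of_conjReflect {c : Fin g → ℂ} {a : ℂ} {m : ℕ} (ha : a ≠ 0)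
    (h : (Polynomial.X - Polynomial.C a) ^ m ∣ conjReflect (g + 1) (unitPoly c)) :
    (Polynomial.X - Polynomial.C (conj a)⁻¹) ^ m ∣ unitPoly c := by
  have h0 : conjReflect (g + 1) (unitPoly c) ≠ 0 := by
    intro h0
    have := conjReflect_conjReflect (g + 1) (unitPoly c)
    rw [h0] at this
    exact unitPoly_ne_zero c (by simp [← this, conjReflect])
  have h1 := X_sub_C_pow_dvd_conjReflect
    (natDegree_conjReflect_le ((natDegree_unitPoly_le c).trans (Nat.le_succ g))) h0 ha h
  rwa [conjReflect_conjReflect] at h1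

section Gcd

variable {c : Fin g → ℂ} {D : ℂ[X]}

theorem IsReciprocalGcd.ne_zero (hD : IsReciprocalGcd c D) : D ≠ 0 := by
  rintro rfl
  exact unitPoly_ne_zero c (zero_dvd_iff.1 ((hD 0).1 dvd_rfl).1)

theorem IsReciprocalGcd.natDegree_eq {D' : ℂ[X]} (hD : IsReciprocalGcd c D)
    (hD' : IsReciprocalGcd c D') : D.natDegree = D'.natDegree :=
  Polynomial.natDegree_eq_of_degree_eq (Polynomial.degree_eq_degree_of_associated
    (associated_of_dvd_dvd ((hD' D).2 ((hD D).1 dvd_rfl)) ((hD D').2 ((hD' D').1 dvd_rfl))))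

theorem IsReciprocalGcd.dvd_unitPoly (hD : IsReciprocalGcd c D) : D ∣ unitPoly c :=
  ((hD D).1 dvd_rfl).1

theorem IsReciprocalGcd.natDegree_le (hD : IsReciprocalGcd c D) {r : ℂ[X]} (h : r ∣ D) :
    r.natDegree ≤ D.natDegree :=
  Polynomial.natDegree_le_of_dvd h hD.ne_zero

theorem IsReciprocalGcd.X_sub_C_dvd_iff (hD : IsReciprocalGcd c D) {a : ℂ} :
    Polynomial.X - Polynomial.C a ∣ D ↔
      (unitPoly c).eval a = 0 ∧ (unitPoly c).eval (conj a)⁻¹ = 0 := by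
  rw [hD, Polynomial.dvd_iff_isRoot, Polynomial.dvd_iff_isRoot]
  exact and_congr_right fun ha =>
    eval_conjReflect_unitPoly_eq_zero_iff c (ne_zero_of_eval_unitPoly ha)

theorem IsReciprocalGcd.X_sub_C_sq_dvd_iff (hD : IsReciprocalGcd c D) {a : ℂ} :
    (Polynomial.X - Polynomial.C a) ^ 2 ∣ D ↔ (Polynomial.X - Polynomial.C a) ^ 2 ∣ unitPoly c ∧
      (Polynomial.X - Polynomial.C (conj a)⁻¹) ^ 2 ∣ unitPoly c := by
  rw [hD]
  refine and_congr_right fun ha => ?_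
  have ha0 : a ≠ 0 := ne_zero_of_eval_unitPoly
    (X_sub_C_dvd_unitPoly_iff.1 ((dvd_pow_self _ two_ne_zero).trans ha))
  constructor
  · exact X_sub_C_pow_dvd_of_conjReflect ha0
  · intro h
    have h1 := X_sub_C_pow_dvd_conjReflect_unitPoly (by simpa using ha0) h
    rwa [conj_inv_conj_inv] at h1

theorem IsReciprocalGcd.pairPoly_dvd (hD : IsReciprocalGcd c D) {a : ℂ} (h : ‖a‖ ≠ 1)
    (ha : (unitPoly c).eval a = 0) (ha' : (unitPoly c).eval (conj a)⁻¹ = 0) : pairPoly a ∣ D :=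
  (isCoprime_X_sub_C (conj_inv_ne_self (ne_zero_of_eval_unitPoly ha) h).symm).mul_dvd
    (hD.X_sub_C_dvd_iff.2 ⟨ha, ha'⟩)
    (hD.X_sub_C_dvd_iff.2 ⟨ha', by rwa [conj_inv_conj_inv]⟩)

end Gcd

theorem eval_derivative_ne_zero {p : ℂ[X]} {a : ℂ} (hp : p.eval a = 0)
    (h : ¬ (Polynomial.X - Polynomial.C a) ^ 2 ∣ p) : p.derivative.eval a ≠ 0 := by
  intro hd
  have hp0 : p ≠ 0 := by
    rintro rfl
    simp at h
  have h1 : 1 < p.rootMultiplicity a :=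
    (Polynomial.one_lt_rootMultiplicity_iff_isRoot hp0).2 ⟨hp, hd⟩
  exact h ((Polynomial.le_rootMultiplicity_iff hp0).1 h1)

/-- A double root on the circle or a second reciprocal root would contribute a divisor of degree 2
to the gcd. -/
theorem isSmoothPointOfDim_of_natDegree_eq_one {n : WithTop ℕ∞} {c : Fin g → ℂ} {D : ℂ[X]}
    (hc : c ∈ unimodularLocus g) (hD : IsReciprocalGcd c D) (hdeg : D.natDegree = 1) :
    IsSmoothPointOfDim (Fin g → ℂ) n (reciprocalLocus g) (2 * g - 1) c := by
  obtain ⟨w, hw, h0⟩ := hc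
  have hself := (conj_inv_eq_self_iff (ne_zero_of_eval_unitPoly h0)).2 hw
  refine isSmoothPointOfDim_of_unimodular_root hw h0 (eval_derivative_ne_zero h0 fun h => ?_)
    fun a ha ha' => ?_
  · have := hD.natDegree_le (hD.X_sub_C_sq_dvd_iff.2 ⟨h, by rwa [hself]⟩)
    rw [natDegree_X_sub_C_pow] at this
    omega
  · by_contra hne
    have := hD.natDegree_le ((isCoprime_X_sub_C hne).mul_dvd (hD.X_sub_C_dvd_iff.2 ⟨ha, ha'⟩)
      (hD.X_sub_C_dvd_iff.2 ⟨h0, by rwa [hself]⟩))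
    rw [Polynomial.natDegree_mul (Polynomial.X_sub_C_ne_zero _) (Polynomial.X_sub_C_ne_zero _),
      Polynomial.natDegree_X_sub_C, Polynomial.natDegree_X_sub_C] at this
    omega

theorem isSmoothPointOfDim_of_natDegree_eq_two {n : WithTop ℕ∞} {c : Fin g → ℂ} {D : ℂ[X]}
    (hc : c ∈ reciprocalLocus g \ unimodularLocus g) (hD : IsReciprocalGcd c D)
    (hdeg : D.natDegree = 2) :
    IsSmoothPointOfDim (Fin g → ℂ) n (reciprocalLocus g) (2 * g - 2) c := by
  obtain ⟨hc, hcS⟩ := hc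
  obtain ⟨a, ha, ha'⟩ := mem_reciprocalLocus_iff.1 hc
  have hoff : ∀ b, (unitPoly c).eval b = 0 → ‖b‖ ≠ 1 := fun b hb h => hcS ⟨b, h, hb⟩
  have hg : 2 ≤ g := by
    simpa [natDegree_pairPoly] using
      natDegree_le_of_dvd_unitPoly (pairPoly_dvd_unitPoly (hoff a ha) ha ha')
  have huniq : ∀ b, (unitPoly c).eval b = 0 → (unitPoly c).eval (conj b)⁻¹ = 0 →
      b = a ∨ b = (conj a)⁻¹ := by
    intro b hb hb'
    by_contra! hne
    have := hD.natDegree_le ((isCoprime_pairPoly hne.1 hne.2).mul_dvd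
      (hD.pairPoly_dvd (hoff b hb) hb hb') (hD.pairPoly_dvd (hoff a ha) ha ha'))
    rw [Polynomial.natDegree_mul (pairPoly_monic _).ne_zero (pairPoly_monic _).ne_zero,
      natDegree_pairPoly, natDegree_pairPoly] at this
    omega
  -- One member of the pair may be multiple in `unitPoly c`, but not both, since then the gcd would
  -- have degree at least 4. The simple member is the one to follow.
  by_cases h1 : (Polynomial.X - Polynomial.C a) ^ 2 ∣ unitPoly c
  · refine isSmoothPointOfDim_of_reciprocal_roots (hoff _ ha') ha' (by rwa [conj_inv_conj_inv])
      (eval_derivative_ne_zero ha' fun h2 => ?_) hg fun b hb hb' => ?_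
    · have hne := conj_inv_ne_self (ne_zero_of_eval_unitPoly ha) (hoff a ha)
      have hcop : IsCoprime ((Polynomial.X - Polynomial.C a) ^ 2)
          ((Polynomial.X - Polynomial.C (conj a)⁻¹) ^ 2) := (isCoprime_X_sub_C hne.symm).pow
      have e1 : (Polynomial.X - Polynomial.C a) ^ 2 ∣ D := hD.X_sub_C_sq_dvd_iff.2 ⟨h1, h2⟩
      have e2 : (Polynomial.X - Polynomial.C (conj a)⁻¹) ^ 2 ∣ D :=
        hD.X_sub_C_sq_dvd_iff.2 ⟨h2, by rw [conj_inv_conj_inv]; exact h1⟩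
      have := hD.natDegree_le (hcop.mul_dvd e1 e2)
      rw [Polynomial.natDegree_mul (pow_ne_zero _ (Polynomial.X_sub_C_ne_zero _))
        (pow_ne_zero _ (Polynomial.X_sub_C_ne_zero _)), natDegree_X_sub_C_pow,
        natDegree_X_sub_C_pow] at this
      omega
    · rw [conj_inv_conj_inv]
      exact (huniq b hb hb').symm
  · exact isSmoothPointOfDim_of_reciprocal_roots (hoff a ha) ha ha'
      (eval_derivative_ne_zero ha h1) hg huniq

/-! ### Density of the points with minimal gcd. -/

theorem continuous_coeffVec_mul_comp (r u : ℂ[X]) : Continuous fun t : ℝ =>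
    coeffVec g (r * u.comp (Polynomial.C (t : ℂ) * Polynomial.X)) := by
  refine continuous_pi fun k => ?_
  simp only [coeffVec_apply, Polynomial.coeff_mul, Polynomial.comp_C_mul_X_coeff]
  fun_prop

/-- Near a parameter for which `unitPoly c` is divisible by a self-reciprocal polynomial `r`, there
are parameters for which `r` is the greatest common divisor. -/
theorem frequently_isReciprocalGcd {c : Fin g → ℂ} {r : ℂ[X]} {κ : ℂ} (hκ : κ ≠ 0)
    (hr : conjReflect r.natDegree r = Polynomial.C κ * r) (hc : r ∣ unitPoly c) :
    ∃ᶠ c' in 𝓝 c, IsReciprocalGcd c' r := by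
  obtain ⟨u, hu⟩ := hc
  have hu0 : r * u ≠ 0 := hu ▸ unitPoly_ne_zero c
  have hr0 := left_ne_zero_of_mul hu0
  have hu0 := right_ne_zero_of_mul hu0
  have hdeg : r.natDegree + u.natDegree ≤ g := by
    rw [← Polynomial.natDegree_mul hr0 hu0, ← hu]
    exact natDegree_unitPoly_le c
  have hcoeff : r.coeff 0 * u.coeff 0 = 1 := by
    rw [← Polynomial.mul_coeff_zero, ← hu, unitPoly_coeff_zero]
  -- Rescaling the variable divides the roots of the cofactor by `t` and keeps its constant term.
  set f : ℝ → ℂ[X] := fun t => u.comp (Polynomial.C (t : ℂ) * Polynomial.X) with hf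
  have hfdeg : ∀ t, (f t).natDegree ≤ u.natDegree := by
    intro t
    refine Polynomial.natDegree_comp_le.trans ?_
    exact (Nat.mul_le_mul_left _ ((Polynomial.natDegree_C_mul_le _ _).trans
      Polynomial.natDegree_X_le)).trans_eq (mul_one _)
  have hpoly : ∀ t, unitPoly (coeffVec g (r * f t)) = r * f t := by
    intro t
    refine unitPoly_coeffVec ?_ (Polynomial.natDegree_mul_le.trans ?_)
    · rw [Polynomial.mul_coeff_zero, hf, Polynomial.comp_C_mul_X_coeff]
      simpa using hcoeff
    · have := hfdeg t
      omega
  have hlim : Tendsto (fun t : ℝ => coeffVec g (r * f t)) (𝓝[>] 1) (𝓝 c) := by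
    have h1 := (continuous_coeffVec_mul_comp (g := g) r u).tendsto 1
    simp only [Complex.ofReal_one, map_one, one_mul, Polynomial.comp_X, ← hu,
      coeffVec_unitPoly] at h1
    exact h1.mono_left nhdsWithin_le_nhds
  refine hlim.frequently (Eventually.frequently ?_)
  -- A reciprocal pair of roots of `f t` comes from roots `x`, `y` of `u` with `x * conj y = t ^ 2`.
  -- This excludes finitely many `t`. The value 1 is erased so that `s` stays away from the limit,
  -- and `t > 1` takes care of it.
  let s : Finset ℝ := ((u.roots.toFinset ×ˢ u.roots.toFinset).image
    fun p => (p.1 * conj p.2).re).erase 1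
  have hs : ∀ᶠ t in 𝓝[>] (1 : ℝ), t ^ 2 ∉ s := by
    have h1 : ∀ᶠ x in 𝓝 ((1 : ℝ) ^ 2), x ∉ (s : Set ℝ) :=
      s.finite_toSet.isClosed.isOpen_compl.mem_nhds (by simp [s])
    exact ((continuous_pow 2).continuousAt.eventually h1).filter_mono nhdsWithin_le_nhds
  filter_upwards [hs, self_mem_nhdsWithin] with t ht ht1
  have ht1 : 1 < t := ht1
  set v := conjReflect (g + 1 - r.natDegree) (f t) with hv
  have hv' : conjReflect (g + 1) (r * f t) = Polynomial.C κ * r * v := by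
    have := hfdeg t
    have e : g + 1 = r.natDegree + (g + 1 - r.natDegree) := by omega
    rw [e, conjReflect_mul le_rfl (by omega), hr]
  have hcop : IsCoprime (f t) v := by
    rw [Polynomial.isCoprime_iff_aeval_ne_zero_of_isAlgClosed ℂ ℂ]
    intro a
    by_contra! h
    obtain ⟨h1, h2⟩ := h
    rw [Polynomial.coe_aeval_eq_eval] at h1 h2
    have ha : a ≠ 0 := by
      rintro rfl
      rw [hf] at h1
      simp only [Polynomial.eval_comp, Polynomial.eval_mul, Polynomial.eval_X, mul_zero] at h1
      rw [Polynomial.coeff_zero_eq_eval_zero u, h1, mul_zero] at hcoeff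
      exact zero_ne_one hcoeff
    have := hfdeg t
    rw [hv, eval_conjReflect (by omega) ha] at h2
    have h2 : (f t).eval (conj a)⁻¹ = 0 := by simpa [ha] using h2
    simp only [hf, Polynomial.eval_comp, Polynomial.eval_mul, Polynomial.eval_X,
      Polynomial.eval_C] at h1 h2
    refine ht ?_
    simp only [s, Finset.mem_erase, Finset.mem_image, Finset.mem_product, Multiset.mem_toFinset,
      Polynomial.mem_roots hu0, Polynomial.IsRoot.def]
    refine ⟨by nlinarith, ((t : ℂ) * a, (t : ℂ) * (conj a)⁻¹), ⟨h1, h2⟩, ?_⟩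
    have : (t : ℂ) * a * conj ((t : ℂ) * (conj a)⁻¹) = ((t ^ 2 : ℝ) : ℂ) := by
      simp only [map_mul, Complex.conj_ofReal, map_inv₀, Complex.conj_conj]
      push_cast
      field_simp
    simp only [this, Complex.ofReal_re]
  intro d
  rw [hpoly, hv']
  constructor
  · exact fun h => ⟨h.mul_right _, (h.mul_left _).mul_right _⟩
  · rintro ⟨h1, h2⟩
    have hC : IsUnit (Polynomial.C κ : ℂ[X]) := Polynomial.isUnit_C.2 hκ.isUnit
    rw [mul_assoc, hC.dvd_mul_left] at h2
    obtain ⟨x, y, hxy⟩ := hcop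
    have : r = x * (r * f t) + y * (r * v) := by linear_combination (-r) * hxy
    rw [this]
    exact (h1.mul_left _).add (h2.mul_left _)

theorem frequently_natDegree_eq_one {c : Fin g → ℂ} (hc : c ∈ unimodularLocus g) :
    ∃ᶠ c' in 𝓝 c, c' ∈ unimodularLocus g ∧ ∃ D, IsReciprocalGcd c' D ∧ D.natDegree = 1 := by
  obtain ⟨w, hw, h0⟩ := hc
  have hw0 := ne_zero_of_eval_unitPoly h0
  have h := frequently_isReciprocalGcd (c := c) (r := Polynomial.X - Polynomial.C w)
    (κ := -conj w) (by simpa using hw0)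
    (by rw [Polynomial.natDegree_X_sub_C, conjReflect_one_X_sub_C hw0,
      (conj_inv_eq_self_iff hw0).2 hw])
    (X_sub_C_dvd_unitPoly_iff.2 h0)
  refine h.mono fun c' hc' => ⟨⟨w, hw, ?_⟩, _, hc', Polynomial.natDegree_X_sub_C w⟩
  exact X_sub_C_dvd_unitPoly_iff.1 hc'.dvd_unitPoly

theorem frequently_natDegree_eq_two {c : Fin g → ℂ}
    (hc : c ∈ reciprocalLocus g \ unimodularLocus g) :
    ∃ᶠ c' in 𝓝 c, c' ∈ reciprocalLocus g \ unimodularLocus g ∧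
      ∃ D, IsReciprocalGcd c' D ∧ D.natDegree = 2 := by
  obtain ⟨hc, hcS⟩ := hc
  obtain ⟨a, ha, ha'⟩ := mem_reciprocalLocus_iff.1 hc
  have ha0 := ne_zero_of_eval_unitPoly ha
  have h := frequently_isReciprocalGcd (c := c) (r := pairPoly a)
    (κ := -conj a * -conj (conj a)⁻¹) (by simpa using ha0)
    (by
      rw [natDegree_pairPoly, pairPoly, conjReflect_mul (N := 1) (K := 1)
        (Polynomial.natDegree_X_sub_C _).le (Polynomial.natDegree_X_sub_C _).le,
        conjReflect_one_X_sub_C ha0, conjReflect_one_X_sub_C (by simpa using ha0),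
        conj_inv_conj_inv, Polynomial.C_mul]
      ring)
    (pairPoly_dvd_unitPoly (fun h => hcS ⟨a, h, ha⟩) ha ha')
  have hS : ∀ᶠ c' in 𝓝 c, c' ∉ unimodularLocus g :=
    isClosed_unimodularLocus.isOpen_compl.mem_nhds hcS
  refine (h.and_eventually hS).mono fun c' hc' => ⟨⟨?_, hc'.2⟩, _, hc'.1, natDegree_pairPoly a⟩
  exact mem_reciprocalLocus_of_pairPoly_dvd hc'.1.dvd_unitPoly

/-- A smooth point shares its dimension with nearby points of the locus, among them points with gcd
of degree 1, where the dimension is known. -/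
theorem IsSmoothPointOfDim.dim_eq_of_unimodular {n : WithTop ℕ∞} (hn : n ≠ 0) {c : Fin g → ℂ}
    {j : ℕ} (hc : c ∈ unimodularLocus g)
    (h : IsSmoothPointOfDim (Fin g → ℂ) n (reciprocalLocus g) j c) : j = 2 * g - 1 := by
  obtain ⟨c', ⟨hc', D, hD, hdeg⟩, hj⟩ :=
    ((frequently_natDegree_eq_one hc).and_eventually h.eventually).exists
  exact (hj (unimodularLocus_subset hc')).dim_unique hn
    (isSmoothPointOfDim_of_natDegree_eq_one hc' hD hdeg)

theorem IsSmoothPointOfDim.dim_eq_of_not_unimodular {n : WithTop ℕ∞} (hn : n ≠ 0)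
    {c : Fin g → ℂ} {j : ℕ} (hc : c ∈ reciprocalLocus g \ unimodularLocus g)
    (h : IsSmoothPointOfDim (Fin g → ℂ) n (reciprocalLocus g) j c) : j = 2 * g - 2 := by
  obtain ⟨c', ⟨hc', D, hD, hdeg⟩, hj⟩ :=
    ((frequently_natDegree_eq_two hc).and_eventually h.eventually).exists
  exact (hj hc'.1).dim_unique hn (isSmoothPointOfDim_of_natDegree_eq_two hc' hD hdeg)

/-! ### Singularity at points with larger gcd. -/

/-- Polynomials of small degree are sums of multiples of two coprime polynomials. -/
theorem exists_add_eq_of_isCoprime {P Q h : ℂ[X]} (hQ : Q.Monic) (hP : P ≠ 0)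
    (hPQ : IsCoprime P Q) {m : ℕ} (hm : P.natDegree + Q.natDegree ≤ m) (hh : h.degree < m) :
    ∃ f₁ f₂, h = f₁ + f₂ ∧ P ∣ f₁ ∧ Q ∣ f₂ ∧ f₁.degree < m ∧ f₂.degree < m := by
  -- Bézout gives `h = P x h + Q y h`; reducing `x h` modulo `Q` bounds the degrees of both
  -- summands.
  obtain ⟨x, y, hxy⟩ := hPQ
  have hdiv := Polynomial.modByMonic_add_div (x * h) Q
  have hd : (P * ((x * h) %ₘ Q)).degree < m := by
    refine lt_of_lt_of_le ?_ (Nat.cast_le.2 hm : ((P.natDegree + Q.natDegree : ℕ) : WithBot ℕ) ≤ m)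
    rw [Polynomial.degree_mul, Nat.cast_add, ← Polynomial.degree_eq_natDegree hP,
      ← Polynomial.degree_eq_natDegree hQ.ne_zero]
    exact WithBot.add_lt_add_left (Polynomial.degree_ne_bot.2 hP)
      (Polynomial.degree_modByMonic_lt _ hQ)
  refine ⟨P * ((x * h) %ₘ Q), h - P * ((x * h) %ₘ Q), by ring, dvd_mul_right _ _,
    ⟨y * h + P * ((x * h) /ₘ Q), ?_⟩, hd, ?_⟩
  · linear_combination (-h) * hxy - P * hdiv
  · exact (Polynomial.degree_sub_le _ _).trans_lt (max_lt hh hd)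

/-- If `unitPoly c` has two coprime factors each of which forces the parameter to lie in the locus,
then the locus can only be smooth at `c` if it contains a neighbourhood of `c`. -/
theorem IsSmoothPointOfDim.dim_eq_of_isCoprime {n : WithTop ℕ∞} (hn : n ≠ 0) {c : Fin g → ℂ}
    {j : ℕ} (h : IsSmoothPointOfDim (Fin g → ℂ) n (reciprocalLocus g) j c) {P Q : ℂ[X]}
    (hQ : Q.Monic) (hPQ : IsCoprime P Q) (hPc : P ∣ unitPoly c) (hQc : Q ∣ unitPoly c)
    (hP' : ∀ c' : Fin g → ℂ, P ∣ unitPoly c' → c' ∈ reciprocalLocus g)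
    (hQ' : ∀ c' : Fin g → ℂ, Q ∣ unitPoly c' → c' ∈ reciprocalLocus g) : j = 2 * g := by
  obtain ⟨T, hT, hT'⟩ := h.exists_tangentSpace hn
  -- The line `u + t X f` keeps the constant term 1 and the divisor `R`, so it lies in the locus and
  -- its direction is tangent.
  have key : ∀ R f : ℂ[X], R ∣ unitPoly c →
      (∀ c' : Fin g → ℂ, R ∣ unitPoly c' → c' ∈ reciprocalLocus g) → R ∣ f →
      f.degree < g → coeffVec g (Polynomial.X * f) ∈ T := by
    intro R f hRc hR' hRf hf
    rw [hT']
    refine ⟨fun t => c + t • coeffVec g (Polynomial.X * f), by simp, ?_, .of_forall fun t => ?_⟩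
    · simpa using ((hasDerivAt_id (0 : ℝ)).smul_const
        (coeffVec g (Polynomial.X * f))).const_add c
    · refine hR' (c + t • coeffVec g (Polynomial.X * f)) ?_
      have e : t • coeffVec g (Polynomial.X * f) =
          coeffVec g (Polynomial.C (t : ℂ) * (Polynomial.X * f)) := by
        ext k
        simp [coeffVec_apply]
      rw [e, unitPoly_add_coeffVec]
      · exact hRc.add ((hRf.mul_left _).mul_left _)
      · simp
      · rcases eq_or_ne f 0 with rfl | hf0
        · simp
        · refine (Polynomial.natDegree_C_mul_le _ _).trans (Polynomial.natDegree_mul_le.trans ?_)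
          have := (Polynomial.natDegree_lt_iff_degree_lt hf0).2 hf
          rw [Polynomial.natDegree_X]
          omega
  have hP0 : P ≠ 0 := by
    rintro rfl
    exact unitPoly_ne_zero c (zero_dvd_iff.1 hPc)
  have hdeg : P.natDegree + Q.natDegree ≤ g := by
    rw [← Polynomial.natDegree_mul hP0 hQ.ne_zero]
    exact natDegree_le_of_dvd_unitPoly (hPQ.mul_dvd hPc hQc)
  have htop : T = ⊤ := by
    rw [eq_top_iff]
    rintro v -
    -- An arbitrary vector `v` is the coefficient vector of `X * divX (unitPoly v)`, so splitting
    -- this quotient along `P` and `Q` puts `v` in `T`.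
    have hX : (unitPoly v).divX.degree < g := by
      rw [Polynomial.degree_lt_iff_coeff_zero]
      intro m hm
      rw [Polynomial.coeff_divX]
      exact Polynomial.coeff_eq_zero_of_natDegree_lt
        ((natDegree_unitPoly_le v).trans_lt (Nat.lt_succ_of_le hm))
    obtain ⟨f₁, f₂, hf, h1, h2, hd1, hd2⟩ := exists_add_eq_of_isCoprime hQ hP0 hPQ hdeg hX
    have hv : v = coeffVec g (Polynomial.X * f₁) + coeffVec g (Polynomial.X * f₂) := by
      rw [← map_add, ← mul_add, ← hf]
      ext k
      rw [coeffVec_apply, Polynomial.coeff_X_mul, Polynomial.coeff_divX, unitPoly_coeff_succ]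
    rw [hv]
    exact T.add_mem (key P f₁ hPc hP' h1 hd1) (key Q f₂ hQc hQ' h2 hd2)
  rw [← hT, htop, finrank_top, finrank_coeffs]

theorem tendsto_coeffVec_mul {f : ℝ → ℂ[X]} {h : ℂ[X]} {c : Fin g → ℂ} {l : Filter ℝ}
    {p q : ℂ[X]} {s : ℝ → ℂ} (hf : ∀ t, f t = p + Polynomial.C (s t) * q) (hs : Tendsto s l (𝓝 0))
    (hc : unitPoly c = p * h) : Tendsto (fun t => coeffVec g (f t * h)) l (𝓝 c) := by
  have e : ∀ t, coeffVec g (f t * h) = c + s t • coeffVec g (q * h) := by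
    intro t
    rw [hf, add_mul, map_add, ← hc, coeffVec_unitPoly, mul_assoc, ← Polynomial.smul_eq_C_mul,
      map_smul]
  simp only [e]
  simpa using (hs.smul_const (coeffVec g (q * h))).const_add c

/-- Near a parameter with a double root on the unit circle there are parameters with two distinct
roots on the unit circle. -/
theorem exists_two_unimodular_roots {c : Fin g → ℂ} {w : ℂ} (hw : ‖w‖ = 1)
    (hc : (Polynomial.X - Polynomial.C w) ^ 2 ∣ unitPoly c) {p : (Fin g → ℂ) → Prop}
    (hp : ∀ᶠ c' in 𝓝 c, p c') :
    ∃ c', p c' ∧ ∃ w₁ w₂ : ℂ, ‖w₁‖ = 1 ∧ ‖w₂‖ = 1 ∧ w₁ ≠ w₂ ∧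
      (unitPoly c').eval w₁ = 0 ∧ (unitPoly c').eval w₂ = 0 := by
  obtain ⟨u, hu⟩ := hc
  have hw0 : w ≠ 0 := by
    rintro rfl
    simp at hw
  let ζ : ℝ → ℂ := fun θ => Complex.exp (θ * Complex.I)
  have hζn : ∀ θ, ‖ζ θ‖ = 1 := Complex.norm_exp_ofReal_mul_I
  have hζ1 : ∀ θ, ζ θ * conj (ζ θ) = 1 := by
    intro θ
    rw [Complex.mul_conj, Complex.normSq_eq_norm_sq, hζn]
    simp
  -- The double root is split symmetrically along the circle into `w e^{iθ}` and `w e^{-iθ}`. Their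
  -- product is still `w²`, so the constant term does not change.
  let f : ℝ → ℂ[X] := fun θ => (Polynomial.X - Polynomial.C (w * ζ θ)) *
    (Polynomial.X - Polynomial.C (w * conj (ζ θ)))
  have hf : ∀ θ, f θ = (Polynomial.X - Polynomial.C w) ^ 2 +
      Polynomial.C (2 - ζ θ - conj (ζ θ)) * (Polynomial.C w * Polynomial.X) := by
    intro θ
    have h1 : Polynomial.C (ζ θ) * Polynomial.C (conj (ζ θ)) = (1 : ℂ[X]) := by
      rw [← Polynomial.C_mul, hζ1, Polynomial.C_1]
    have h2 : (Polynomial.C 2 : ℂ[X]) = 2 := rfl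
    simp only [f, Polynomial.C_mul, Polynomial.C_sub, h2]
    linear_combination Polynomial.C w ^ 2 * h1
  have hcont : Continuous ζ := by fun_prop
  have hs : Tendsto (fun θ => 2 - ζ θ - conj (ζ θ)) (𝓝[>] 0) (𝓝 0) := by
    have : Continuous fun θ => 2 - ζ θ - conj (ζ θ) := by fun_prop
    have h0 := this.tendsto 0
    have e : 2 - ζ 0 - conj (ζ 0) = 0 := by
      simp [ζ]
      norm_num
    rw [e] at h0
    exact h0.mono_left nhdsWithin_le_nhds
  have hlim := tendsto_coeffVec_mul (g := g) hf hs hu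
  have hpi : ∀ᶠ θ in 𝓝[>] (0 : ℝ), θ < Real.pi :=
    (eventually_lt_nhds Real.pi_pos).filter_mono nhdsWithin_le_nhds
  obtain ⟨θ, ⟨hpθ, hθpi⟩, hθ0⟩ :=
    (((hlim.eventually hp).and hpi).and self_mem_nhdsWithin).exists
  have hθ0 : 0 < θ := hθ0
  have hpoly : unitPoly (coeffVec g (f θ * u)) = f θ * u := by
    refine unitPoly_coeffVec ?_ ?_
    · have h0 : (f θ).coeff 0 = ((Polynomial.X - Polynomial.C w) ^ 2).coeff 0 := by
        rw [hf]
        simp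
      rw [Polynomial.mul_coeff_zero, h0, ← Polynomial.mul_coeff_zero, ← hu, unitPoly_coeff_zero]
    · have h1 : ((Polynomial.X - Polynomial.C w) ^ 2 * u).natDegree ≤ g :=
        hu ▸ natDegree_unitPoly_le c
      have hu0 : u ≠ 0 := by
        rintro rfl
        exact unitPoly_ne_zero c (by rw [hu, mul_zero])
      rw [Polynomial.natDegree_mul (pow_ne_zero _ (Polynomial.X_sub_C_ne_zero _)) hu0,
        natDegree_X_sub_C_pow] at h1
      refine Polynomial.natDegree_mul_le.trans ((Nat.add_le_add_right ?_ _).trans h1)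
      refine Polynomial.natDegree_mul_le.trans ?_
      rw [Polynomial.natDegree_X_sub_C, Polynomial.natDegree_X_sub_C]
  refine ⟨_, hpθ, w * ζ θ, w * conj (ζ θ), ?_, ?_, ?_, ?_, ?_⟩
  · rw [norm_mul, hw, hζn, one_mul]
  · rw [norm_mul, hw, RCLike.norm_conj, hζn, one_mul]
  · intro h
    have h1 := congrArg Complex.im (mul_left_cancel₀ hw0 h)
    rw [Complex.conj_im, Complex.exp_ofReal_mul_I_im] at h1
    have := Real.sin_pos_of_pos_of_lt_pi hθ0 hθpi
    linarith
  · rw [hpoly]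
    simp [f]
  · rw [hpoly]
    simp [f]

/-- Near a parameter with a double pair of reciprocal roots there are parameters with two distinct
pairs of reciprocal roots. -/
theorem exists_two_reciprocal_pairs {c : Fin g → ℂ} {a : ℂ} (ha0 : a ≠ 0) (ha : ‖a‖ ≠ 1)
    (hc : pairPoly a ^ 2 ∣ unitPoly c) {p : (Fin g → ℂ) → Prop} (hp : ∀ᶠ c' in 𝓝 c, p c') :
    ∃ c', p c' ∧ ∃ b : ℂ, a ≠ b ∧ a ≠ (conj b)⁻¹ ∧
      pairPoly a ∣ unitPoly c' ∧ pairPoly b ∣ unitPoly c' := by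
  obtain ⟨u, hu⟩ := hc
  rw [pow_two, mul_assoc] at hu
  have hne := conj_inv_ne_self ha0 ha
  -- One copy of the pair moves radially to `e^t a` and `e^{-t} / conj a`; the product of the two
  -- roots, hence the constant term, is preserved.
  have hf : ∀ t : ℝ, pairPoly (Real.exp t * a) = pairPoly a +
      Polynomial.C (a + (conj a)⁻¹ - Real.exp t * a - Real.exp (-t) * (conj a)⁻¹) *
        Polynomial.X := by
    intro t
    have h1 : Polynomial.C ((Real.exp t : ℝ) : ℂ) * Polynomial.C ((Real.exp (-t) : ℝ) : ℂ) =
        (1 : ℂ[X]) := by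
      rw [← Polynomial.C_mul, ← Complex.ofReal_mul, ← Real.exp_add]
      simp
    have h2 : (conj ((Real.exp t : ℝ) * a))⁻¹ = ((Real.exp (-t) : ℝ) : ℂ) * (conj a)⁻¹ := by
      rw [map_mul, Complex.conj_ofReal, mul_inv, Real.exp_neg, Complex.ofReal_inv]
    rw [pairPoly, pairPoly, h2]
    simp only [Polynomial.C_mul, Polynomial.C_sub, Polynomial.C_add]
    linear_combination Polynomial.C a * Polynomial.C (conj a)⁻¹ * h1
  have hs : Tendsto (fun t : ℝ => a + (conj a)⁻¹ - Real.exp t * a - Real.exp (-t) * (conj a)⁻¹)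
      (𝓝[>] 0) (𝓝 0) := by
    have : Continuous fun t : ℝ =>
        a + (conj a)⁻¹ - Real.exp t * a - Real.exp (-t) * (conj a)⁻¹ := by fun_prop
    have h0 := this.tendsto 0
    simp only [Real.exp_zero, neg_zero, Complex.ofReal_one, one_mul, add_sub_cancel_left,
      sub_self] at h0
    exact h0.mono_left nhdsWithin_le_nhds
  have hlim := tendsto_coeffVec_mul (g := g) hf hs hu
  have hne' : ∀ᶠ t in 𝓝[>] (0 : ℝ), ((Real.exp t : ℝ) : ℂ) * a ≠ (conj a)⁻¹ := by
    have : Continuous fun t : ℝ => ((Real.exp t : ℝ) : ℂ) * a := by fun_prop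
    refine (this.continuousAt.eventually_ne ?_).filter_mono nhdsWithin_le_nhds
    simpa using hne.symm
  obtain ⟨t, ⟨hpt, htne⟩, ht0⟩ :=
    (((hlim.eventually hp).and hne').and self_mem_nhdsWithin).exists
  have ht0 : 0 < t := ht0
  have hpoly : unitPoly (coeffVec g (pairPoly (Real.exp t * a) * (pairPoly a * u))) =
      pairPoly (Real.exp t * a) * (pairPoly a * u) := by
    refine unitPoly_coeffVec ?_ ?_
    · have h0 : (pairPoly (Real.exp t * a)).coeff 0 = (pairPoly a).coeff 0 := by
        rw [hf]
        simp
      rw [Polynomial.mul_coeff_zero, h0, ← Polynomial.mul_coeff_zero, ← hu, unitPoly_coeff_zero]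
    · have h1 : (pairPoly a * (pairPoly a * u)).natDegree ≤ g := hu ▸ natDegree_unitPoly_le c
      have hu0 : pairPoly a * u ≠ 0 := by
        intro h
        exact unitPoly_ne_zero c (by rw [hu, h, mul_zero])
      rw [Polynomial.natDegree_mul (pairPoly_monic _).ne_zero hu0, natDegree_pairPoly] at h1 ⊢
      exact h1
  refine ⟨_, hpt, Real.exp t * a, ?_, ?_, ?_, ?_⟩
  · intro h
    have h1 : (1 : ℂ) * a = (Real.exp t : ℝ) * a := by rw [one_mul]; exact h
    have h2 : (1 : ℝ) = Real.exp t := by exact_mod_cast mul_right_cancel₀ ha0 h1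
    exact ht0.ne' (Real.exp_eq_one_iff t |>.1 h2.symm)
  · intro h
    exact htne ((conj_inv_conj_inv _).symm.trans (congrArg (fun z => (conj z)⁻¹) h.symm))
  · rw [hpoly]
    exact (dvd_mul_right _ _).mul_left _
  · rw [hpoly]
    exact dvd_mul_right _ _

/-- A divisor of a polynomial of larger degree is completed by a root of the quotient. -/
theorem exists_mul_X_sub_C_dvd {D r : ℂ[X]} (hD : D ≠ 0) (hr : r ∣ D)
    (hdeg : r.natDegree < D.natDegree) : ∃ b, r * (Polynomial.X - Polynomial.C b) ∣ D := by
  obtain ⟨q, rfl⟩ := hr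
  have hq : q.degree ≠ 0 := by
    intro h
    have h0 : q.natDegree = 0 := Polynomial.natDegree_eq_of_degree_eq_some h
    rw [Polynomial.natDegree_mul (left_ne_zero_of_mul hD) (right_ne_zero_of_mul hD)] at hdeg
    omega
  obtain ⟨b, hb⟩ := IsAlgClosed.exists_root q hq
  exact ⟨b, mul_dvd_mul_left r (Polynomial.dvd_iff_isRoot.2 hb)⟩

theorem IsSmoothPointOfDim.natDegree_eq_one {n : WithTop ℕ∞} (hn : n ≠ 0) {c : Fin g → ℂ} {j : ℕ}
    {D : ℂ[X]} (hc : c ∈ unimodularLocus g) (hD : IsReciprocalGcd c D)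
    (h : IsSmoothPointOfDim (Fin g → ℂ) n (reciprocalLocus g) j c) : D.natDegree = 1 := by
  have hj := h.dim_eq_of_unimodular hn hc
  obtain ⟨w, hw, h0⟩ := hc
  have hself := (conj_inv_eq_self_iff (ne_zero_of_eval_unitPoly h0)).2 hw
  have hwD : Polynomial.X - Polynomial.C w ∣ D := hD.X_sub_C_dvd_iff.2 ⟨h0, by rwa [hself]⟩
  have hwc := X_sub_C_dvd_unitPoly_iff.2 h0
  have hg := natDegree_le_of_dvd_unitPoly hwc
  rw [Polynomial.natDegree_X_sub_C] at hg
  by_contra hne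
  have hle := hD.natDegree_le hwD
  rw [Polynomial.natDegree_X_sub_C] at hle
  obtain ⟨b, hb⟩ := exists_mul_X_sub_C_dvd hD.ne_zero hwD
    (by rw [Polynomial.natDegree_X_sub_C]; omega)
  obtain ⟨hb1, hb2⟩ := hD.X_sub_C_dvd_iff.1 (dvd_of_mul_left_dvd hb)
  -- Here `1 ≤ g` matters: it makes `2 * g` differ from the truncated difference `2 * g - 1`.
  suffices j = 2 * g by omega
  rcases eq_or_ne w b with rfl | hwb
  · rw [← pow_two] at hb
    obtain ⟨c', hc', w₁, w₂, hw₁, hw₂, h12, e1, e2⟩ :=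
      exists_two_unimodular_roots hw (hb.trans hD.dvd_unitPoly) h.eventually
    exact (hc' (unimodularLocus_subset ⟨w₁, hw₁, e1⟩)).dim_eq_of_isCoprime hn
      (Polynomial.monic_X_sub_C w₂) (isCoprime_X_sub_C h12) (X_sub_C_dvd_unitPoly_iff.2 e1)
      (X_sub_C_dvd_unitPoly_iff.2 e2) (fun _ => mem_reciprocalLocus_of_X_sub_C_dvd hw₁)
      (fun _ => mem_reciprocalLocus_of_X_sub_C_dvd hw₂)
  · by_cases hb' : ‖b‖ = 1
    · exact h.dim_eq_of_isCoprime hn (Polynomial.monic_X_sub_C b) (isCoprime_X_sub_C hwb) hwc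
        (X_sub_C_dvd_unitPoly_iff.2 hb1) (fun _ => mem_reciprocalLocus_of_X_sub_C_dvd hw)
        (fun _ => mem_reciprocalLocus_of_X_sub_C_dvd hb')
    · refine h.dim_eq_of_isCoprime hn (pairPoly_monic b) (isCoprime_X_sub_C_pairPoly hwb ?_) hwc
        (pairPoly_dvd_unitPoly hb' hb1 hb2) (fun _ => mem_reciprocalLocus_of_X_sub_C_dvd hw)
        (fun _ => mem_reciprocalLocus_of_pairPoly_dvd)
      rintro rfl
      simp [hb'] at hw

theorem IsReciprocalGcd.two_le_natDegree {c : Fin g → ℂ} {D : ℂ[X]}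
    (hc : c ∈ reciprocalLocus g \ unimodularLocus g) (hD : IsReciprocalGcd c D) :
    2 ≤ D.natDegree := by
  obtain ⟨hc, hcS⟩ := hc
  obtain ⟨a, ha, ha'⟩ := mem_reciprocalLocus_iff.1 hc
  simpa [natDegree_pairPoly] using
    hD.natDegree_le (hD.pairPoly_dvd (fun h => hcS ⟨a, h, ha⟩) ha ha')

theorem IsSmoothPointOfDim.natDegree_eq_two {n : WithTop ℕ∞} (hn : n ≠ 0) {c : Fin g → ℂ} {j : ℕ}
    {D : ℂ[X]} (hc : c ∈ reciprocalLocus g \ unimodularLocus g) (hD : IsReciprocalGcd c D)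
    (h : IsSmoothPointOfDim (Fin g → ℂ) n (reciprocalLocus g) j c) : D.natDegree = 2 := by
  have hj := h.dim_eq_of_not_unimodular hn hc
  have hle := hD.two_le_natDegree hc
  obtain ⟨hc, hcS⟩ := hc
  obtain ⟨a, ha, ha'⟩ := mem_reciprocalLocus_iff.1 hc
  have hoff : ∀ b, (unitPoly c).eval b = 0 → ‖b‖ ≠ 1 := fun b hb h => hcS ⟨b, h, hb⟩
  have ha0 := ne_zero_of_eval_unitPoly ha
  have haD := hD.pairPoly_dvd (hoff a ha) ha ha'
  have hac := pairPoly_dvd_unitPoly (hoff a ha) ha ha'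
  have hg := natDegree_le_of_dvd_unitPoly hac
  rw [natDegree_pairPoly] at hg
  by_contra hne
  obtain ⟨b, hb⟩ := exists_mul_X_sub_C_dvd hD.ne_zero haD (by rw [natDegree_pairPoly]; omega)
  obtain ⟨hb1, hb2⟩ := hD.X_sub_C_dvd_iff.1 (dvd_of_mul_left_dvd hb)
  suffices j = 2 * g by omega
  -- If the further root `b` of the gcd belongs to the pair of `a`, the square condition on the gcd
  -- is symmetric under reciprocation, so the whole pair is double.
  have hdouble : pairPoly a ^ 2 ∣ unitPoly c → j = 2 * g := by
    intro h2
    obtain ⟨c', hc', b, hab, hab', e1, e2⟩ :=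
      exists_two_reciprocal_pairs ha0 (hoff a ha) h2 h.eventually
    exact (hc' (mem_reciprocalLocus_of_pairPoly_dvd e1)).dim_eq_of_isCoprime hn
      (pairPoly_monic b) (isCoprime_pairPoly hab hab') e1 e2
      (fun _ => mem_reciprocalLocus_of_pairPoly_dvd)
      (fun _ => mem_reciprocalLocus_of_pairPoly_dvd)
  have hcop : IsCoprime ((Polynomial.X - Polynomial.C a) ^ 2)
      ((Polynomial.X - Polynomial.C (conj a)⁻¹) ^ 2) :=
    (isCoprime_X_sub_C (conj_inv_ne_self ha0 (hoff a ha)).symm).pow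
  by_cases hab : b = a
  · have h1 : (Polynomial.X - Polynomial.C a) ^ 2 ∣ D := by
      refine dvd_trans ?_ hb
      rw [hab, pairPoly]
      exact ⟨Polynomial.X - Polynomial.C (conj a)⁻¹, by ring⟩
    have h2 := hD.X_sub_C_sq_dvd_iff.1 h1
    refine hdouble ?_
    rw [pairPoly, mul_pow]
    exact hcop.mul_dvd h2.1 h2.2
  by_cases hab' : b = (conj a)⁻¹
  · have h1 : (Polynomial.X - Polynomial.C (conj a)⁻¹) ^ 2 ∣ D := by
      refine dvd_trans ?_ hb
      rw [hab', pairPoly]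
      exact ⟨Polynomial.X - Polynomial.C a, by ring⟩
    have h2 := hD.X_sub_C_sq_dvd_iff.1 h1
    rw [conj_inv_conj_inv] at h2
    refine hdouble ?_
    rw [pairPoly, mul_pow]
    exact hcop.mul_dvd h2.2 h2.1
  · exact h.dim_eq_of_isCoprime hn (pairPoly_monic a) (isCoprime_pairPoly hab hab')
      (pairPoly_dvd_unitPoly (hoff b hb1) hb1 hb2) hac
      (fun _ => mem_reciprocalLocus_of_pairPoly_dvd)
      (fun _ => mem_reciprocalLocus_of_pairPoly_dvd)

/-! ### Local dimensions and the theorem. -/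

theorem hasLocalDim_of_unimodular {n : WithTop ℕ∞} (hn : n ≠ 0) {c : Fin g → ℂ}
    (hc : c ∈ unimodularLocus g) :
    HasLocalDim (Fin g → ℂ) n (reciprocalLocus g) c (2 * g - 1) := by
  refine ⟨(frequently_natDegree_eq_one hc).mono ?_, .of_forall fun y j hj => ?_⟩
  · rintro c' ⟨hc', D, hD, hdeg⟩
    exact isSmoothPointOfDim_of_natDegree_eq_one hc' hD hdeg
  · by_cases hy : y ∈ unimodularLocus g
    · exact (hj.dim_eq_of_unimodular hn hy).le
    · have := hj.dim_eq_of_not_unimodular hn ⟨hj.1, hy⟩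
      omega

/-- The unimodular locus is closed, so only smooth points off it, all of dimension `2 * g - 2`,
occur near `c`. -/
theorem hasLocalDim_of_not_unimodular {n : WithTop ℕ∞} (hn : n ≠ 0) {c : Fin g → ℂ}
    (hc : c ∈ reciprocalLocus g \ unimodularLocus g) :
    HasLocalDim (Fin g → ℂ) n (reciprocalLocus g) c (2 * g - 2) := by
  refine ⟨(frequently_natDegree_eq_two hc).mono ?_, ?_⟩
  · rintro c' ⟨hc', D, hD, hdeg⟩
    exact isSmoothPointOfDim_of_natDegree_eq_two hc' hD hdeg
  · have hS : ∀ᶠ y in 𝓝 c, y ∉ unimodularLocus g :=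
      isClosed_unimodularLocus.isOpen_compl.mem_nhds hc.2
    filter_upwards [hS] with y hy j hj
    exact (hj.dim_eq_of_not_unimodular hn ⟨hj.1, hy⟩).le

end ReciprocalRoots

theorem mainTheorem7 (g : ℕ) (n : WithTop ℕ∞) (hn : ∞ ≤ n) (B : OpenGrassmannian g) :
    (B ∈ circleRootLocus g →
      HasLocalDim (ℂ →L[ℝ] midCoeffs g) n (commonRootLocus g) B (2 * g - 1) ∧
      (IsSmoothPoint (ℂ →L[ℝ] midCoeffs g) n (commonRootLocus g) B ↔
        (planeGcd B).natDegree = 1)) ∧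
    (B ∈ commonRootLocus g \ circleRootLocus g →
      HasLocalDim (ℂ →L[ℝ] midCoeffs g) n (commonRootLocus g) B (2 * g - 2) ∧
      (IsSmoothPoint (ℂ →L[ℝ] midCoeffs g) n (commonRootLocus g) B ↔
        (planeGcd B).natDegree = 2) ∧
      IsLeast ((fun B' => (planeGcd B').natDegree) '' (commonRootLocus g \ circleRootLocus g))
        2) := by
  have hn0 : n ≠ 0 := by
    rintro rfl
    simp at hn
  have hmem : ∀ B : OpenGrassmannian g, B ∈ commonRootLocus g \ circleRootLocus g ↔
      planeCoords g n B ∈ reciprocalLocus g \ unimodularLocus g := fun B => by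
    rw [Set.mem_sdiff, Set.mem_sdiff, mem_commonRootLocus_iff n, mem_circleRootLocus_iff n]
  have hD := isReciprocalGcd_planeGcd (g := g) n
  simp only [IsSmoothPoint, isSmoothPointOfDim_iff_planeCoords, hasLocalDim_iff_planeCoords]
  refine ⟨fun hB => ?_, fun hB => ?_⟩
  · rw [mem_circleRootLocus_iff n] at hB
    exact ⟨hasLocalDim_of_unimodular hn0 hB, fun ⟨_, h⟩ => h.natDegree_eq_one hn0 hB (hD B),
      fun h => ⟨_, isSmoothPointOfDim_of_natDegree_eq_one hB (hD B) h⟩⟩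
  · rw [hmem] at hB
    refine ⟨hasLocalDim_of_not_unimodular hn0 hB,
      ⟨fun ⟨_, h⟩ => h.natDegree_eq_two hn0 hB (hD B),
        fun h => ⟨_, isSmoothPointOfDim_of_natDegree_eq_two hB (hD B) h⟩⟩, ?_, ?_⟩
    -- The value 2 is attained at a perturbation of `B` itself.
    · obtain ⟨c, hc, D, hD', hdeg⟩ := (frequently_natDegree_eq_two hB).exists
      obtain ⟨B', rfl⟩ := (planeCoords g n).surjective c
      exact ⟨B', (hmem B').2 hc, ((hD B').natDegree_eq hD').trans hdeg⟩
    · rintro _ ⟨B', hB', rfl⟩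
      exact (hD B').two_le_natDegree ((hmem B').1 hB')
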